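/- Let $\nu\in\{2,3\}$ and let $\sigma>0$. There are constants $\beta>0$ and $C>0$, depending only on $\nu$ and $\sigma$, such that the following holds. Setting. Let $\Omega_1,\Omega_2\subset\mathbb{R}^\nu$ be disjoint bounded open sets, let $\gamma=\partial\Omega_1\cap\partial\Omega_2$ be their interface and $\Gamma_i=\partial\Omega_i\setminus\gamma$. For $i=1,2$ let $\Omega_i^h$ be a conforming (face-to-face) finite element mesh of $\Omega_i$, where $\Omega_i$ is the interior of the union of the cells. Each cell is the image of the unit simplex under an affine map or of the unit cube under a multilinear ($Q_1$) map, and $\{N_{i,r}\}$ is the nodal basis of the lowest-order ($P_1$, respectively mapped $Q_1$) $C^0$ Lagrange space. Each mesh is quasi-uniform with characteristic element size $h_i>0$ and constant $\sigma$: every cell has diameter at most $\sigma h_i$, and every cell (for a non-affine element map: every tangent cell, that is, the image of the reference cell under the linearization of the element map at any of its points) contains a ball of radius $h_i/\sigma$. For each $i$, $\gamma$ is a union of facets of $\Omega_i^h$; the two induced interface meshes need not match. A node of $\Omega_i^h$ is an interface node if it lies in $\gamma\setminus\overline{\Gamma_i}$ and an interior node if it lies in $\Omega_i$. Composite reduced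 basis. For $i=1,2$ let $\Phi_{i,\gamma}$ and $\Phi_{i,0}$ be real matrices with linearly independent columns, whose rows are indexed by the interface, respectively interior, nodes of $\Omega_i^h$. Let $\widetilde S^h_{i,\gamma}$ and $\widetilde S^h_{i,0}$ be the spans of the finite element functions whose nodal coefficients are the columns of these matrices (all other coefficients being zero). Fix $k\in\{1,2\}$ such that $\Phi_{k,\gamma}$ has at least one column, and put $$\widetilde V^h_C=(\widetilde S^h_{1,\gamma}+\widetilde S^h_{1,0})\times(\widetilde S^h_{2,\gamma}+\widetilde S^h_{2,0}),\qquad \widetilde W^h=\widetilde G^h_k=\{v|_\gamma: v\in\widetilde S^h_{k,\gamma}\},$$ $$a(u,v)=(u_1,v_1)_{0,\Omega_1}+(u_2,v_2)_{0,\Omega_2},\qquad b(v;\mu)=(v_1-v_2,\mu)_{0,\gamma},$$ $$\|v\|_V^2=\|v_1\|_{0,\Omega_1}^2+\|v_2\|_{0,\Omega_2}^2,\qquad \|\mu\|_W=\|\mu\|_{0,\gamma}.$$ Let $M_{i,pq}$ ($p,q\in\{\gamma,0\}$) be the blocks of the mass matrix of $\{N_{i,r}\}$ in $L^2(\Omega_i)$,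 let $(G_{i,\gamma})_{lr}=(N_{k,l},N_{i,r})_{0,\gamma}$ for interface nodes $l$ of $\Omega_k^h$ and $r$ of $\Omega_i^h$, and set $$\widetilde M_i=\big(\Phi_{i,p}^TM_{i,pq}\Phi_{i,q}\big)_{p,q\in\{\gamma,0\}},\qquad \widetilde G_i=\big(\Phi_{k,\gamma}^TG_{i,\gamma}\Phi_{i,\gamma},\;0\big),\qquad \widetilde S=\widetilde G_1\widetilde M_1^{-1}\widetilde G_1^T+\widetilde G_2\widetilde M_2^{-1}\widetilde G_2^T.$$ Conclusions. 1. There is a linear operator $\mathcal Q:\widetilde W^h\to\widetilde V^h_C$ such that $b(\mathcal Q\mu;\mu)=\|\mu\|_W^2$ and $\|\mathcal Q\mu\|_V\le C\,h_k^{1/2}\|\mu\|_W$ for all $\mu\in\widetilde W^h$. 2. If $h_k<1$, the inf-sup condition $$\sup_{0\ne v\in\widetilde V^h_C}\frac{b(v;\mu)}{\|v\|_V}\ \ge\ \beta\,\|\mu\|_W\qquad\text{for all }\mu\in\widetilde W^h$$ holds; in particular $\beta$ does not depend on the mesh sizes or on the reduced-basis dimensions. 3. $a(v,v)\ge\|v\|_V^2$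 for all $v\in\widetilde V^h_C$, the projected mass matrices $\widetilde M_1,\widetilde M_2$ are symmetric positive definite, $\widetilde G^T=(\widetilde G_1,-\widetilde G_2)^T$ has full column rank, and the Schur complement $\widetilde S$ is symmetric positive definite. -/

import Mathlib

open MeasureTheory
open scoped Matrix

namespace CoupledFEM

/-- The Euclidean space `ℝ^ν`. -/
abbrev Pt (ν : ℕ) : Type := EuclideanSpace ℝ (Fin ν)

/-! ### Lowest-order Lagrange reference elements -/

/-- The two reference cells: the unit simplex (carrying the space `P₁`) and the unit cube
(carrying the space `Q₁`). -/
inductive RefCell : Type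
  | simplex
  | cube

namespace RefCell

/-- The vertices of a reference cell. Simplex: `none` is the origin, `some i` is `e_i`.
Cube: `b` is the vertex whose `i`-th coordinate is `1` if `b i = true` and `0` otherwise. -/
def Vertex (ν : ℕ) : RefCell → Type
  | simplex => Option (Fin ν)
  | cube => Fin ν → Bool

instance instFintypeVertex (ν : ℕ) (c : RefCell) : Fintype (c.Vertex ν) :=
  match c with
  | simplex => inferInstanceAs (Fintype (Option (Fin ν)))
  | cube => inferInstanceAs (Fintype (Fin ν → Bool))

/-- The closed reference cell. -/
def body (ν : ℕ) : RefCell → Set (Fin ν → ℝ)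
  | simplex => {x | (∀ i, 0 ≤ x i) ∧ ∑ i, x i ≤ 1}
  | cube => {x | ∀ i, 0 ≤ x i ∧ x i ≤ 1}

/-- The nodal shape functions: barycentric coordinates on the simplex, multilinear functions on
the cube. -/
def shape (ν : ℕ) : (c : RefCell) → c.Vertex ν → (Fin ν → ℝ) → ℝ
  | simplex, none => fun x => 1 - ∑ i, x i
  | simplex, some i => fun x => x i
  | cube, b => fun x => ∏ i, (if b i = true then x i else 1 - x i)

/-- The closed facets (faces of dimension `ν - 1`) of the reference cell. -/
def facets (ν : ℕ) : RefCell → Set (Set (Fin ν → ℝ))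
  | simplex => Set.range fun v : Option (Fin ν) => {x | x ∈ body ν simplex ∧ shape ν simplex v x = 0}
  | cube => Set.range fun p : Fin ν × Bool =>
      {x | x ∈ body ν cube ∧ x p.1 = if p.2 = true then 1 else 0}

end RefCell

/-! ### Meshes -/

/-- The data of a finite element mesh in `ℝ^ν`: nodes (= mesh vertices), cells, the shape of each
cell, and the node sitting at each vertex of each cell. -/
structure Mesh (ν : ℕ) where
  nNode : ℕ
  node : Fin nNode → Pt ν
  nCell : ℕ
  kind : Fin nCell → RefCell
  vert : (K : Fin nCell) → (kind K).Vertex ν → Fin nNode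

namespace Mesh

variable {ν : ℕ} (T : Mesh ν)

/-- The element map of the cell `K`: the `P₁` (hence affine) or `Q₁` map taking the vertices of the
reference cell to the vertices of `K`. -/
noncomputable def map (K : Fin T.nCell) (x : Fin ν → ℝ) : Pt ν :=
  ∑ v, (T.kind K).shape ν v x • T.node (T.vert K v)

/-- The closed cell `K`. -/
def cell (K : Fin T.nCell) : Set (Pt ν) :=
  T.map K '' (T.kind K).body ν

/-- The nodal basis function of the node `r` on the cell `K`, pulled back to the reference cell. -/
noncomputable def localBasis (K : Fin T.nCell) (r : Fin T.nNode) (x : Fin ν → ℝ) : ℝ :=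
  ∑ v, if T.vert K v = r then (T.kind K).shape ν v x else 0

/-- `T` is a conforming (face-to-face) mesh: each node is a vertex of some cell, the vertices of
a cell are distinct nodes, cells do not overlap, and cells match where they meet, so that the nodal
basis functions are single-valued. For a mesh of simplices the last condition says that the element
maps are injective and that two cells meet exactly in the convex hull of their common vertices. -/
structure Conforming : Prop where
  node_mem : ∀ r, ∃ K v, T.vert K v = r
  vert_injective : ∀ K, Function.Injective (T.vert K)
  interior_disjoint : ∀ K L, K ≠ L → Disjoint (interior (T.cell K)) (interior (T.cell L))
  matching : ∀ K L, ∀ x ∈ (T.kind K).body ν, ∀ y ∈ (T.kind L).body ν,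
    T.map K x = T.map L y → ∀ r, T.localBasis K r x = T.localBasis L r y

/-- `T` is shape-regular and quasi-uniform with characteristic element size `h` and constant `σ`:
all cells have diameter at most `σ h`, and all tangent cells contain a ball of radius `h / σ`.
The tangent cell at `x` is the image of the reference cell under the first-order expansion of the
element map at `x`. If the element map is affine (simplices, parallelotopes), this is the cell
itself; at a vertex of a convex quadrilateral it is the parallelogram spanned by the two adjacent
edges. -/
def QuasiUniform (h σ : ℝ) : Prop :=
  ∀ K, Metric.diam (T.cell K) ≤ σ * h ∧
    ∀ x ∈ (T.kind K).body ν, ∃ c : Pt ν, Metric.closedBall c (h / σ) ⊆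
      (fun y => T.map K x + fderiv ℝ (T.map K) x (y - x)) '' (T.kind K).body ν

open Classical in
/-- The global nodal basis function `N_r` (extended by zero outside the mesh). -/
noncomputable def basis (r : Fin T.nNode) (p : Pt ν) : ℝ :=
  if hp : ∃ K, ∃ x ∈ (T.kind K).body ν, T.map K x = p then
    T.localBasis hp.choose r hp.choose_spec.choose
  else 0

/-- On a conforming mesh, `N_r` restricted to each cell is the corresponding shape function. -/
theorem basis_map (hT : T.Conforming) (r : Fin T.nNode) (K : Fin T.nCell) (x : Fin ν → ℝ)
    (hx : x ∈ (T.kind K).body ν) : T.basis r (T.map K x) = T.localBasis K r x := by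
  have hp : ∃ L, ∃ y ∈ (T.kind L).body ν, T.map L y = T.map K x := ⟨K, x, hx, rfl⟩
  rw [basis, dif_pos hp]
  exact hT.matching _ _ _ hp.choose_spec.choose_spec.1 _ hx hp.choose_spec.choose_spec.2 r

/-- The open region partitioned by the mesh: the interior of the union of its cells. -/
def region : Set (Pt ν) :=
  interior (⋃ K, T.cell K)

/-- The finite element function with coefficients `Φ r j` at the nodes `e r`, for fixed `j`. -/
noncomputable def column {ι : Type} [Fintype ι] {d : ℕ} (e : ι → Fin T.nNode)
    (Φ : Matrix ι (Fin d) ℝ) (j : Fin d) : Pt ν → ℝ :=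
  fun p => ∑ r, Φ r j * T.basis (e r) p

end Mesh

/-! ### Two subdomains and their interface -/

/-- A mesh for each of the two subdomains (indexed by `0, 1 : Fin 2`). -/
structure Coupled (ν : ℕ) where
  mesh : Fin 2 → Mesh ν

namespace Coupled

variable {ν : ℕ} (P : Coupled ν)

/-- The subdomain `Ω_i`. -/
def Ω (i : Fin 2) : Set (Pt ν) := (P.mesh i).region

/-- The interface `γ`. -/
def γ : Set (Pt ν) := frontier (P.Ω 0) ∩ frontier (P.Ω 1)

/-- The Dirichlet boundary `Γ_i = ∂Ω_i \ γ`. -/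
def Γ (i : Fin 2) : Set (Pt ν) := frontier (P.Ω i) \ P.γ

/-- Both meshes are conforming, the subdomains do not overlap, and each of the two meshes induces
a partition of the interface: `γ` is a union of facets of cells (the two partitions of `γ` need not
match). -/
structure Admissible : Prop where
  conforming : ∀ i, (P.mesh i).Conforming
  disjoint : Disjoint (P.Ω 0) (P.Ω 1)
  interface : ∀ i, ∀ p ∈ P.γ, ∃ K, ∃ f ∈ ((P.mesh i).kind K).facets ν,
    p ∈ (P.mesh i).map K '' f ∧ (P.mesh i).map K '' f ⊆ P.γ

/-- The interface nodes of `Ω_i`: the nodes on `γ` that do not also lie on the (closed) Dirichlet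
boundary. -/
abbrev IfaceNode (i : Fin 2) : Type :=
  {r : Fin (P.mesh i).nNode // (P.mesh i).node r ∈ P.γ ∧ (P.mesh i).node r ∉ closure (P.Γ i)}

/-- The interior nodes of `Ω_i`. -/
abbrev InnerNode (i : Fin 2) : Type :=
  {r : Fin (P.mesh i).nNode // (P.mesh i).node r ∈ P.Ω i}

noncomputable instance instFintypeIfaceNode (i : Fin 2) : Fintype (P.IfaceNode i) :=
  Fintype.ofFinite _

noncomputable instance instFintypeInnerNode (i : Fin 2) : Fintype (P.InnerNode i) :=
  Fintype.ofFinite _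

/-- The inclusion of the interface nodes into all nodes. -/
def ifaceIdx (i : Fin 2) : P.IfaceNode i → Fin (P.mesh i).nNode := Subtype.val

/-- The inclusion of the interior nodes into all nodes. -/
def innerIdx (i : Fin 2) : P.InnerNode i → Fin (P.mesh i).nNode := Subtype.val

/-- Surface measure on the interface. -/
noncomputable def surface : Measure P.γ :=
  (μHE[ν - 1] : Measure (Pt ν)).comap Subtype.val

/-- Restriction (trace) to the interface. -/
def trace : (Pt ν → ℝ) →ₗ[ℝ] (P.γ → ℝ) where
  toFun v := fun p => v p
  map_add' _ _ := rfl
  map_smul' _ _ := rfl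

/-! ### Bilinear forms and norms -/

/-- The form `a(u, v) = (u₁, v₁)_{0,Ω₁} + (u₂, v₂)_{0,Ω₂}`. -/
noncomputable def a (u v : (Pt ν → ℝ) × (Pt ν → ℝ)) : ℝ :=
  (∫ p in P.Ω 0, u.1 p * v.1 p) + ∫ p in P.Ω 1, u.2 p * v.2 p

/-- The constraint form `b(v; μ) = (v₁ - v₂, μ)_{0,γ}`. -/
noncomputable def b (v : (Pt ν → ℝ) × (Pt ν → ℝ)) (μ : P.γ → ℝ) : ℝ :=
  ∫ p, (P.trace v.1 p - P.trace v.2 p) * μ p ∂P.surface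

/-- The broken `L²` norm on pairs. -/
noncomputable def normV (v : (Pt ν → ℝ) × (Pt ν → ℝ)) : ℝ :=
  Real.sqrt ((∫ p in P.Ω 0, v.1 p ^ 2) + ∫ p in P.Ω 1, v.2 p ^ 2)

/-- The `L²(γ)` norm. -/
noncomputable def normW (μ : P.γ → ℝ) : ℝ :=
  Real.sqrt (∫ p, μ p ^ 2 ∂P.surface)

/-! ### Full order matrices -/

/-- The mass matrix of `Ω_i` with respect to two families of nodes. -/
noncomputable def mass (i : Fin 2) {ι κ : Type} (e : ι → Fin (P.mesh i).nNode)
    (f : κ → Fin (P.mesh i).nNode) : Matrix ι κ ℝ :=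
  Matrix.of fun r s => ∫ p in P.Ω i, (P.mesh i).basis (e r) p * (P.mesh i).basis (f s) p

/-- The interface block `G_{i,γ}` of the constraint matrix, when the multiplier space is the trace
space of `Ω_k`. -/
noncomputable def constraint (k i : Fin 2) : Matrix (P.IfaceNode k) (P.IfaceNode i) ℝ :=
  Matrix.of fun l r => ∫ p, P.trace ((P.mesh k).basis l.1) p * P.trace ((P.mesh i).basis r.1) p
    ∂P.surface

/-! ### Composite reduced basis -/

/-- A composite reduced basis: for each subdomain a matrix `Φ_{i,γ}` of interface modes and a
matrix `Φ_{i,0}` of interior modes, each with linearly independent columns. -/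
structure ReducedBasis where
  dγ : Fin 2 → ℕ
  d0 : Fin 2 → ℕ
  Φγ : (i : Fin 2) → Matrix (P.IfaceNode i) (Fin (dγ i)) ℝ
  Φ0 : (i : Fin 2) → Matrix (P.InnerNode i) (Fin (d0 i)) ℝ
  linearIndependent_γ : ∀ i, LinearIndependent ℝ (Φγ i).col
  linearIndependent_0 : ∀ i, LinearIndependent ℝ (Φ0 i).col

namespace ReducedBasis

variable {P} (R : P.ReducedBasis)

/-- The reduced space spanned by the interface modes. -/
noncomputable def Sγ (i : Fin 2) : Submodule ℝ (Pt ν → ℝ) :=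
  Submodule.span ℝ (Set.range ((P.mesh i).column (P.ifaceIdx i) (R.Φγ i)))

/-- The reduced space spanned by the interior modes. -/
noncomputable def S0 (i : Fin 2) : Submodule ℝ (Pt ν → ℝ) :=
  Submodule.span ℝ (Set.range ((P.mesh i).column (P.innerIdx i) (R.Φ0 i)))

/-- The reduced state space: pairs of functions from the composite spaces on `Ω₁` and `Ω₂`. -/
noncomputable def V : Submodule ℝ ((Pt ν → ℝ) × (Pt ν → ℝ)) :=
  (R.Sγ 0 ⊔ R.S0 0).prod (R.Sγ 1 ⊔ R.S0 1)

/-- The reduced multiplier space: traces of the interface modes of `Ω_k`. -/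
noncomputable def W (k : Fin 2) : Submodule ℝ (P.γ → ℝ) :=
  (R.Sγ k).map P.trace

/-- The projected mass matrix of `Ω_i`. -/
noncomputable def M (i : Fin 2) :
    Matrix (Fin (R.dγ i) ⊕ Fin (R.d0 i)) (Fin (R.dγ i) ⊕ Fin (R.d0 i)) ℝ :=
  Matrix.fromBlocks
    ((R.Φγ i)ᵀ * P.mass i (P.ifaceIdx i) (P.ifaceIdx i) * R.Φγ i)
    ((R.Φγ i)ᵀ * P.mass i (P.ifaceIdx i) (P.innerIdx i) * R.Φ0 i)
    ((R.Φ0 i)ᵀ * P.mass i (P.innerIdx i) (P.ifaceIdx i) * R.Φγ i)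
    ((R.Φ0 i)ᵀ * P.mass i (P.innerIdx i) (P.innerIdx i) * R.Φ0 i)

/-- The projected constraint matrix of `Ω_i`: an interface block and a zero interior block. -/
noncomputable def G (k i : Fin 2) : Matrix (Fin (R.dγ k)) (Fin (R.dγ i) ⊕ Fin (R.d0 i)) ℝ :=
  Matrix.fromCols ((R.Φγ k)ᵀ * P.constraint k i * R.Φγ i) 0

/-- The transposed constraint matrix of the coupled problem. -/
noncomputable def GT (k : Fin 2) :
    Matrix ((Fin (R.dγ 0) ⊕ Fin (R.d0 0)) ⊕ (Fin (R.dγ 1) ⊕ Fin (R.d0 1))) (Fin (R.dγ k)) ℝ :=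
  (Matrix.fromCols (R.G k 0) (-R.G k 1))ᵀ

/-- The dual Schur complement. -/
noncomputable def schur (k : Fin 2) : Matrix (Fin (R.dγ k)) (Fin (R.dγ k)) ℝ :=
  R.G k 0 * (R.M 0)⁻¹ * (R.G k 0)ᵀ + R.G k 1 * (R.M 1)⁻¹ * (R.G k 1)ᵀ

/-- The inf-sup condition with constant `β` on the reduced spaces (the supremum is taken in the
extended reals). -/
def InfSup (k : Fin 2) (β : ℝ) : Prop :=
  ∀ μ ∈ R.W k, ((β * P.normW μ : ℝ) : EReal) ≤
    ⨆ v ∈ {v | v ∈ R.V ∧ v ≠ 0}, ((P.b v μ / P.normV v : ℝ) : EReal)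

end ReducedBasis

end Coupled

end CoupledFEM

/-! The multipliers are traces of interface modes of side `k`, so a multiplier can be lifted
linearly to a mode with that trace, placed in component `k` with a sign making `b` of the lift
against the multiplier equal to the squared interface norm. Everything then rests on one inverse
trace estimate: a finite element function `v` whose nodal values `c` vanish off the interface
satisfies `‖v‖_{0,Ω} ≤ C √h ‖v‖_{0,γ}`.

With `n = ν - 1`, the estimate compares both norms with the Euclidean norm of `c`. The volume side
is `∫_Ω v² ≤ const · h^(n+1) · ∑ c²`, from Cauchy–Schwarz and the size of the supports
(`setIntegral_region_fe_sq_le`). The surface side is `∫_γ v² ≥ κ h^n ∑ c²`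
(`exists_sum_sq_le_surface`). There, each interface node is a vertex of a facet inside the
interface; near the vertex of that facet with the largest nodal value, `|v|` is at least half of
this value, on a patch of surface measure at least `const · h^n` (`le_setIntegral_facet`). The
chosen facets overlap boundedly often, by a volume packing argument for cells (`card_cells_le`).
Facets may be curved, so their measure is bounded below through the expansion of distances by the
element map.

For `h_k < 1` the lifting bound gives the inf-sup condition with `β = C⁻¹`. For the matrices, a
finite element function with zero `L²` norm vanishes at all nodes, so the mass matrices are
definite; the surface bound makes the interface Gram matrix of side `k` definite, so one block of
the constraint matrix already has full rank and one summand of the Schur complement is already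
definite. -/

namespace CoupledFEM

/-! ### Geometry and shape functions of the reference cells. -/

namespace RefCell

variable {ν : ℕ}

/-- The position of a vertex of a reference cell. -/
def vertexPt (ν : ℕ) : (c : RefCell) → c.Vertex ν → Fin ν → ℝ
  | simplex, none => 0
  | simplex, some i => Pi.single i 1
  | cube, b => fun i => if b i = true then 1 else 0

theorem shape_contDiff (c : RefCell) (v : c.Vertex ν) : ContDiff ℝ 2 (c.shape ν v) := by
  rcases c with _ | _
  · rcases v with _ | i
    · change ContDiff ℝ 2 fun x : Fin ν → ℝ => 1 - ∑ i, x i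
      fun_prop
    · change ContDiff ℝ 2 fun x : Fin ν → ℝ => x i
      fun_prop
  · change ContDiff ℝ 2 fun x : Fin ν → ℝ => ∏ i, (if v i = true then x i else 1 - x i)
    refine contDiff_prod fun i _ => ?_
    split_ifs <;> fun_prop

theorem shape_continuous (c : RefCell) (v : c.Vertex ν) : Continuous (c.shape ν v) :=
  (shape_contDiff c v).continuous

theorem sum_shape (c : RefCell) (x : Fin ν → ℝ) : ∑ v, c.shape ν v x = 1 := by
  rcases c with _ | _
  · change ∑ v : Option (Fin ν), shape ν simplex v x = 1
    rw [Fintype.sum_option]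
    simp [shape]
  · change ∑ b : Fin ν → Bool, ∏ i, (if b i = true then x i else 1 - x i) = 1
    have := Finset.prod_univ_sum (fun _ : Fin ν => (Finset.univ : Finset Bool))
      (fun i b => if b = true then x i else 1 - x i)
    rw [Fintype.piFinset_univ] at this
    rw [← this]
    simp

theorem shape_nonneg (c : RefCell) (v : c.Vertex ν) {x : Fin ν → ℝ} (hx : x ∈ c.body ν) :
    0 ≤ c.shape ν v x := by
  rcases c with _ | _
  · rcases v with _ | i
    · have := hx.2
      change 0 ≤ 1 - ∑ i, x i
      linarith
    · exact hx.1 i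
  · change 0 ≤ ∏ i, (if v i = true then x i else 1 - x i)
    refine Finset.prod_nonneg fun i _ => ?_
    have := hx i
    split_ifs <;> linarith

theorem body_subset_Icc (c : RefCell) : c.body ν ⊆ Set.Icc 0 1 := by
  intro x hx
  rcases c with _ | _
  · refine ⟨fun i => hx.1 i, fun i => ?_⟩
    exact (Finset.single_le_sum (fun j _ => hx.1 j) (Finset.mem_univ i)).trans hx.2
  · exact ⟨fun i => (hx i).1, fun i => (hx i).2⟩

theorem norm_sub_le_one (c : RefCell) {x y : Fin ν → ℝ} (hx : x ∈ c.body ν) (hy : y ∈ c.body ν) :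
    ‖x - y‖ ≤ 1 := by
  have h1 := body_subset_Icc c hx
  have h2 := body_subset_Icc c hy
  refine (pi_norm_le_iff_of_nonneg zero_le_one).2 fun i => ?_
  have a1 := h1.1 i
  have a2 := h1.2 i
  have b1 := h2.1 i
  have b2 := h2.2 i
  simp only [Pi.zero_apply, Pi.one_apply] at a1 a2 b1 b2
  rw [Pi.sub_apply, Real.norm_eq_abs, abs_le]
  constructor <;> linarith

theorem body_convex (c : RefCell) : Convex ℝ (c.body ν) := by
  rcases c with _ | _
  · intro x hx y hy a b ha hb hab
    refine ⟨fun i => ?_, ?_⟩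
    · have := hx.1 i
      have := hy.1 i
      simp only [Pi.add_apply, Pi.smul_apply, smul_eq_mul]
      positivity
    · simp only [Pi.add_apply, Pi.smul_apply, smul_eq_mul, Finset.sum_add_distrib,
        ← Finset.mul_sum]
      nlinarith [hx.2, hy.2]
  · have : body ν cube = Set.Icc 0 1 := by
      ext x
      simp [body, Set.mem_Icc, Pi.le_def, forall_and]
    rw [this]
    exact convex_Icc _ _

theorem body_isClosed (c : RefCell) : IsClosed (c.body ν) := by
  rcases c with _ | _
  · change IsClosed {x : Fin ν → ℝ | (∀ i, 0 ≤ x i) ∧ ∑ i, x i ≤ 1}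
    refine IsClosed.and ?_ ?_
    · simp only [Set.ofPred_forall]
      exact isClosed_iInter fun i => isClosed_le (by fun_prop) (by fun_prop)
    · exact isClosed_le (by fun_prop) (by fun_prop)
  · have : body ν cube = Set.Icc 0 1 := by
      ext x
      simp [body, Set.mem_Icc, Pi.le_def, forall_and]
    rw [this]
    exact isClosed_Icc

theorem body_isCompact (c : RefCell) : IsCompact (c.body ν) :=
  isCompact_Icc.of_isClosed_subset (body_isClosed c) (body_subset_Icc c)

theorem vertexPt_mem (c : RefCell) (v : c.Vertex ν) : c.vertexPt ν v ∈ c.body ν := by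
  rcases c with _ | _
  · rcases v with _ | i
    · change (∀ i, (0 : ℝ) ≤ (0 : Fin ν → ℝ) i) ∧ ∑ i, (0 : Fin ν → ℝ) i ≤ 1
      simp
    · change (∀ j, (0 : ℝ) ≤ (Pi.single i 1 : Fin ν → ℝ) j) ∧ ∑ j, (Pi.single i 1 : Fin ν → ℝ) j ≤ 1
      refine ⟨fun j => ?_, by simp⟩
      rw [Pi.single_apply]
      split_ifs <;> norm_num
  · intro i
    change (0 : ℝ) ≤ (if v i = true then 1 else 0) ∧ (if v i = true then (1 : ℝ) else 0) ≤ 1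
    split_ifs <;> norm_num

theorem shape_vertexPt (c : RefCell) (v : c.Vertex ν) : c.shape ν v (c.vertexPt ν v) = 1 := by
  rcases c with _ | _
  · rcases v with _ | i
    · change 1 - ∑ i, (0 : Fin ν → ℝ) i = 1
      simp
    · change (Pi.single i 1 : Fin ν → ℝ) i = 1
      simp
  · change ∏ i, (if v i = true then (if v i = true then (1 : ℝ) else 0)
      else 1 - (if v i = true then 1 else 0)) = 1
    refine Finset.prod_eq_one fun i _ => ?_
    split_ifs <;> simp

/-- The shape functions are nonnegative with sum 1, and one of them already takes the value 1 here.
-/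
theorem shape_vertexPt_of_ne (c : RefCell) {v w : c.Vertex ν} (h : w ≠ v) :
    c.shape ν w (c.vertexPt ν v) = 0 := by
  classical
  have h1 := sum_shape c (c.vertexPt ν v)
  rw [← Finset.add_sum_erase _ _ (Finset.mem_univ v), shape_vertexPt] at h1
  have h2 := Finset.single_le_sum (f := fun w => c.shape ν w (c.vertexPt ν v))
    (fun w _ => shape_nonneg c w (vertexPt_mem c v))
    (Finset.mem_erase.2 ⟨h, Finset.mem_univ w⟩)
  have h3 := shape_nonneg c w (vertexPt_mem c v)
  linarith

/-- The centre of a ball contained in the reference cells. -/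
noncomputable def centre (ν : ℕ) : Fin ν → ℝ := fun _ => (2 * ν : ℝ)⁻¹

/-- In the sup norm this ball is the box `[0, 1/ν]^ν`, whose coordinate sums are at most 1, so it
fits in the simplex as well as in the cube. -/
theorem closedBall_centre_subset (hν : 0 < ν) (c : RefCell) :
    Metric.closedBall (centre ν) (2 * ν : ℝ)⁻¹ ⊆ c.body ν := by
  intro x hx
  have hν' : (1 : ℝ) ≤ ν := by exact_mod_cast hν
  have h1 : ∀ i, 0 ≤ x i ∧ x i ≤ (ν : ℝ)⁻¹ := by
    intro i
    have h2 := (dist_le_pi_dist x (centre ν) i).trans hx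
    rw [Real.dist_eq, abs_le, centre, mul_inv] at h2
    constructor <;> linarith
  rcases c with _ | _
  · refine ⟨fun i => (h1 i).1, ?_⟩
    calc ∑ i, x i ≤ ∑ _i : Fin ν, (ν : ℝ)⁻¹ := Finset.sum_le_sum fun i _ => (h1 i).2
      _ = 1 := by simp; field_simp
  · exact fun i => ⟨(h1 i).1, (h1 i).2.trans (inv_le_one_of_one_le₀ hν')⟩

theorem facet_subset (c : RefCell) {f : Set (Fin ν → ℝ)} (hf : f ∈ c.facets ν) :
    f ⊆ c.body ν := by
  rcases c with _ | _
  · obtain ⟨v, rfl⟩ := hf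
    exact fun x hx => hx.1
  · obtain ⟨v, rfl⟩ := hf
    exact fun x hx => hx.1

theorem facet_isClosed (c : RefCell) {f : Set (Fin ν → ℝ)} (hf : f ∈ c.facets ν) :
    IsClosed f := by
  rcases c with _ | _
  · obtain ⟨v, rfl⟩ := hf
    exact (body_isClosed simplex).and (isClosed_eq (shape_continuous simplex v) continuous_const)
  · obtain ⟨v, rfl⟩ := hf
    exact (body_isClosed cube).and (isClosed_eq (by fun_prop) continuous_const)

theorem facet_isCompact (c : RefCell) {f : Set (Fin ν → ℝ)} (hf : f ∈ c.facets ν) :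
    IsCompact f :=
  (body_isCompact c).of_isClosed_subset (facet_isClosed c hf) (facet_subset c hf)

theorem facet_convex (c : RefCell) {f : Set (Fin ν → ℝ)} (hf : f ∈ c.facets ν) :
    Convex ℝ f := by
  rcases c with _ | _
  · obtain ⟨v, rfl⟩ := hf
    refine (body_convex simplex).inter (t := {x | shape ν simplex v x = 0}) ?_
    intro x hx y hy a b ha hb hab
    rcases v with _ | i
    · have hx : 1 - ∑ i, x i = 0 := hx
      have hy : 1 - ∑ i, y i = 0 := hy
      change 1 - ∑ i, (a • x + b • y) i = 0
      simp only [Pi.add_apply, Pi.smul_apply, smul_eq_mul, Finset.sum_add_distrib,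
        ← Finset.mul_sum]
      linear_combination a * hx + b * hy - hab
    · have hx : x i = 0 := hx
      have hy : y i = 0 := hy
      change (a • x + b • y) i = 0
      simp [hx, hy]
  · obtain ⟨p, rfl⟩ := hf
    refine (body_convex cube).inter (t := {x | x p.1 = if p.2 = true then 1 else 0}) ?_
    intro x hx y hy a b ha hb hab
    simp only [Set.mem_ofPred_eq, Pi.add_apply, Pi.smul_apply, smul_eq_mul] at hx hy ⊢
    rw [hx, hy, ← add_mul, hab, one_mul]

theorem facet_finite (c : RefCell) : (c.facets ν).Finite := by
  rcases c with _ | _ <;> exact Set.finite_range _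

/-- Shape functions of vertices off a facet vanish on it; hence values on a facet depend only on the
nodal values at its own vertices. -/
theorem vertexPt_mem_facet (c : RefCell) {f : Set (Fin ν → ℝ)} (hf : f ∈ c.facets ν)
    {v : c.Vertex ν} {x : Fin ν → ℝ} (hx : x ∈ f) (hv : c.shape ν v x ≠ 0) :
    c.vertexPt ν v ∈ f := by
  rcases c with _ | _
  · obtain ⟨w, rfl⟩ := hf
    refine ⟨vertexPt_mem simplex v, ?_⟩
    refine shape_vertexPt_of_ne simplex ?_
    rintro rfl
    exact hv hx.2
  · obtain ⟨p, rfl⟩ := hf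
    refine ⟨vertexPt_mem cube v, ?_⟩
    have hx2 : x p.1 = if p.2 = true then 1 else 0 := hx.2
    change (if v p.1 = true then (1 : ℝ) else 0) = if p.2 = true then 1 else 0
    have h0 : (if v p.1 = true then x p.1 else 1 - x p.1) ≠ 0 := by
      intro h0
      exact hv (Finset.prod_eq_zero (Finset.mem_univ p.1) h0)
    rw [hx2] at h0
    by_cases h1 : v p.1 = true <;> by_cases h2 : p.2 = true <;> simp [h1, h2] at h0 ⊢

/-- Every facet is the image of a planar set under a smooth expanding parametrization which
maps a fixed box into the facet. -/
theorem exists_facet_chart {n : ℕ} (c : RefCell) {f : Set (Fin (n + 1) → ℝ)}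
    (hf : f ∈ c.facets (n + 1)) :
    ∃ φ : (Fin n → ℝ) → (Fin (n + 1) → ℝ), ContDiff ℝ 1 φ ∧
      (∀ z ∈ Set.Icc (0 : Fin n → ℝ) (fun _ => ((n : ℝ) + 1)⁻¹), φ z ∈ f) ∧
      (∀ z w, ‖z - w‖ ≤ ‖φ z - φ w‖) ∧ f ⊆ φ '' Set.Icc 0 1 := by
  -- Each facet lies on a graph `x i = s (other coordinates)`. The chart inserts the missing
  -- coordinate, which cannot decrease the sup norm. The side `1/(n+1)` keeps the coordinate sums of
  -- the box below 1, as the simplex requires.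
  have key : ∀ (i : Fin (n + 1)) (s : (Fin n → ℝ) → ℝ), ContDiff ℝ 1 s →
      (∀ z ∈ Set.Icc (0 : Fin n → ℝ) (fun _ => ((n : ℝ) + 1)⁻¹), i.insertNth (s z) z ∈ f) →
      (∀ x ∈ f, x i = s (i.removeNth x)) →
      ∃ φ : (Fin n → ℝ) → (Fin (n + 1) → ℝ), ContDiff ℝ 1 φ ∧
      (∀ z ∈ Set.Icc (0 : Fin n → ℝ) (fun _ => ((n : ℝ) + 1)⁻¹), φ z ∈ f) ∧
      (∀ z w, ‖z - w‖ ≤ ‖φ z - φ w‖) ∧ f ⊆ φ '' Set.Icc 0 1 := by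
    intro i s hs h1 h2
    refine ⟨fun z => i.insertNth (s z) z, ?_, h1, ?_, ?_⟩
    · refine contDiff_pi.2 fun j => ?_
      rcases Fin.eq_self_or_eq_succAbove i j with rfl | ⟨k, rfl⟩
      · simpa using hs
      · simp only [Fin.insertNth_apply_succAbove]
        fun_prop
    · intro z w
      refine (pi_norm_le_iff_of_nonneg (norm_nonneg _)).2 fun k => ?_
      have := norm_le_pi_norm ((i.insertNth (s z) z : Fin (n + 1) → ℝ) - i.insertNth (s w) w)
        (i.succAbove k)
      simpa using this
    · intro x hx
      refine ⟨i.removeNth x, ?_, ?_⟩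
      · have := body_subset_Icc c (facet_subset c hf hx)
        exact ⟨fun k => this.1 _, fun k => this.2 _⟩
      · simp only
        rw [← h2 x hx, Fin.insertNth_self_removeNth]
  have hn : (0 : ℝ) < (n : ℝ) + 1 := by positivity
  have hn1 : ((n : ℝ) + 1)⁻¹ ≤ 1 := inv_le_one_of_one_le₀ (by linarith [n.cast_nonneg (α := ℝ)])
  have hsum : ∀ z ∈ Set.Icc (0 : Fin n → ℝ) (fun _ => ((n : ℝ) + 1)⁻¹), ∑ i, z i ≤ 1 := by
    intro z hz
    calc ∑ i, z i ≤ ∑ _i : Fin n, ((n : ℝ) + 1)⁻¹ := Finset.sum_le_sum fun i _ => hz.2 i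
      _ ≤ 1 := by
        simp only [Finset.sum_const, Finset.card_univ, Fintype.card_fin, nsmul_eq_mul]
        rw [mul_inv_le_iff₀ hn]
        linarith
  rcases c with _ | _
  · obtain ⟨v, rfl⟩ := hf
    rcases v with _ | i
    · refine key 0 (fun z => 1 - ∑ i, z i) (by fun_prop) ?_ ?_
      · intro z hz
        refine ⟨⟨fun j => ?_, ?_⟩, ?_⟩
        · refine Fin.cases ?_ (fun k => ?_) j
          · simpa using hsum z hz
          · simpa using hz.1 k
        · simp [Fin.sum_univ_succ]
        · simp [shape, Fin.sum_univ_succ]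
      · intro x hx
        have : 1 - ∑ i, x i = 0 := hx.2
        rw [Fin.sum_univ_succ] at this
        simp only [Fin.removeNth, Fin.zero_succAbove]
        linarith
    · refine key i (fun _ => 0) contDiff_const ?_ ?_
      · intro z hz
        refine ⟨⟨fun j => ?_, ?_⟩, ?_⟩
        · rcases Fin.eq_self_or_eq_succAbove i j with rfl | ⟨k, rfl⟩
          · simp
          · simpa using hz.1 k
        · simpa [Fin.sum_univ_succAbove _ i] using hsum z hz
        · simp [shape]
      · intro x hx
        exact hx.2
  · obtain ⟨⟨i, b⟩, rfl⟩ := hf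
    refine key i (fun _ => if b = true then 1 else 0) contDiff_const ?_ ?_
    · intro z hz
      refine ⟨fun j => ?_, by simp⟩
      rcases Fin.eq_self_or_eq_succAbove i j with rfl | ⟨k, rfl⟩
      · simp only [Fin.insertNth_apply_same]
        split_ifs <;> norm_num
      · simp only [Fin.insertNth_apply_succAbove]
        exact ⟨hz.1 k, (hz.2 k).trans hn1⟩
    · intro x hx
      exact hx.2

/-- `m` bounds the number of vertices of the reference cells, and `L` bounds the first two
derivatives of the shape functions. -/
def ShapeBounds (ν : ℕ) (m L : ℝ) : Prop :=
  ∀ c : RefCell, (Fintype.card (c.Vertex ν) : ℝ) ≤ m ∧ ∀ v : c.Vertex ν,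
      (∀ x ∈ c.body ν, ∀ y ∈ c.body ν,
        |c.shape ν v x - c.shape ν v y| ≤ L * ‖x - y‖) ∧
      ∀ x₀ ∈ c.body ν, ∀ ε, 0 ≤ ε → ∀ x ∈ c.body ν ∩ Metric.closedBall x₀ ε,
        ∀ y ∈ c.body ν ∩ Metric.closedBall x₀ ε,
        |c.shape ν v x - c.shape ν v y - fderiv ℝ (c.shape ν v) x₀ (x - y)|
          ≤ L * ε * ‖x - y‖

/-- A smooth function and its derivative are Lipschitz on a compact convex body; the mean value
inequality turns the second bound into the linearization error. Summing over the finitely many shape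
functions of both cells makes the constants depend on `ν` only. -/
theorem exists_shape_bounds (ν : ℕ) : ∃ m L : ℝ, 0 < m ∧ 0 < L ∧ ShapeBounds ν m L := by
  have h1 : ∀ (c : RefCell) (v : c.Vertex ν), ∃ L : ℝ, 0 ≤ L ∧
      (∀ x ∈ c.body ν, ∀ y ∈ c.body ν,
        |c.shape ν v x - c.shape ν v y| ≤ L * ‖x - y‖) ∧
      ∀ x₀ ∈ c.body ν, ∀ ε, 0 ≤ ε → ∀ x ∈ c.body ν ∩ Metric.closedBall x₀ ε,
        ∀ y ∈ c.body ν ∩ Metric.closedBall x₀ ε,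
        |c.shape ν v x - c.shape ν v y - fderiv ℝ (c.shape ν v) x₀ (x - y)|
          ≤ L * ε * ‖x - y‖ := by
    intro c v
    have hs := shape_contDiff c v
    obtain ⟨K₁, hK₁⟩ := (hs.of_le one_le_two).contDiffOn.exists_lipschitzOnWith one_ne_zero
      (body_convex c) (body_isCompact c)
    have hd : ContDiff ℝ 1 (fderiv ℝ (c.shape ν v)) := hs.fderiv_right (by norm_num)
    obtain ⟨K₂, hK₂⟩ := hd.contDiffOn.exists_lipschitzOnWith one_ne_zero
      (body_convex c) (body_isCompact c)
    refine ⟨K₁ + K₂, by positivity, ?_, ?_⟩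
    · intro x hx y hy
      have := hK₁.dist_le_mul x hx y hy
      rw [Real.dist_eq, dist_eq_norm] at this
      refine this.trans ?_
      gcongr
      simp
    · intro x₀ hx₀ ε hε x hx y hy
      have := ((body_convex c).inter (convex_closedBall x₀ ε)).norm_image_sub_le_of_norm_hasFDerivWithin_le'
        (f := c.shape ν v) (f' := fderiv ℝ (c.shape ν v)) (φ := fderiv ℝ (c.shape ν v) x₀)
        (C := K₂ * ε)
        (fun z hz => ((hs.differentiable two_ne_zero) z).hasFDerivAt.hasFDerivWithinAt) ?_ hy hx
      · rw [Real.norm_eq_abs] at this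
        refine this.trans ?_
        gcongr
        simp
      · intro z hz
        have h3 := hK₂.dist_le_mul z hz.1 x₀ hx₀
        rw [dist_eq_norm] at h3
        refine h3.trans ?_
        gcongr
        exact hz.2
  choose L hL0 hL1 hL2 using h1
  refine ⟨Fintype.card (simplex.Vertex ν) + Fintype.card (cube.Vertex ν) + 1,
    (∑ v, L simplex v) + (∑ v, L cube v) + 1, by positivity, ?_, ?_⟩
  · have := Finset.sum_nonneg fun v (_ : v ∈ Finset.univ) => hL0 simplex v
    have := Finset.sum_nonneg fun v (_ : v ∈ Finset.univ) => hL0 cube v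
    linarith
  · intro c
    have hle : ∀ v : c.Vertex ν, L c v ≤ (∑ v, L simplex v) + (∑ v, L cube v) + 1 := by
      intro v
      have h1 := Finset.sum_nonneg fun v (_ : v ∈ Finset.univ) => hL0 simplex v
      have h2 := Finset.sum_nonneg fun v (_ : v ∈ Finset.univ) => hL0 cube v
      have h3 := Finset.single_le_sum (fun v _ => hL0 c v) (Finset.mem_univ v)
      rcases c with _ | _ <;> linarith
    refine ⟨?_, fun v => ⟨?_, ?_⟩⟩
    · have h1 : (0 : ℝ) ≤ Fintype.card (simplex.Vertex ν) := by positivity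
      have h2 : (0 : ℝ) ≤ Fintype.card (cube.Vertex ν) := by positivity
      rcases c with _ | _ <;> linarith
    · intro x hx y hy
      exact (hL1 c v x hx y hy).trans (by gcongr; exact hle v)
    · intro x₀ hx₀ ε hε x hx y hy
      exact (hL2 c v x₀ hx₀ ε hε x hx y hy).trans (by gcongr; exact hle v)

end RefCell

/-! ### Element maps of quasi-uniform meshes. -/

namespace Mesh

variable {ν : ℕ} {T : Mesh ν}

theorem map_contDiff (K : Fin T.nCell) : ContDiff ℝ 2 (T.map K) := by
  unfold map
  exact ContDiff.sum fun v _ => (RefCell.shape_contDiff _ v).smul contDiff_const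

theorem map_continuous (K : Fin T.nCell) : Continuous (T.map K) :=
  (map_contDiff K).continuous

theorem map_vertexPt (K : Fin T.nCell) (v : (T.kind K).Vertex ν) :
    T.map K ((T.kind K).vertexPt ν v) = T.node (T.vert K v) := by
  rw [map, Fintype.sum_eq_single v]
  · rw [RefCell.shape_vertexPt, one_smul]
  · intro w hw
    rw [RefCell.shape_vertexPt_of_ne _ hw, zero_smul]

theorem cell_isCompact (K : Fin T.nCell) : IsCompact (T.cell K) :=
  (RefCell.body_isCompact _).image (map_continuous K)

theorem map_mem_cell (K : Fin T.nCell) {x : Fin ν → ℝ} (hx : x ∈ (T.kind K).body ν) :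
    T.map K x ∈ T.cell K :=
  Set.mem_image_of_mem _ hx

theorem node_mem_cell (K : Fin T.nCell) (v : (T.kind K).Vertex ν) :
    T.node (T.vert K v) ∈ T.cell K :=
  map_vertexPt K v ▸ map_mem_cell K (RefCell.vertexPt_mem _ v)

theorem fderiv_map_apply (K : Fin T.nCell) (x w : Fin ν → ℝ) :
    fderiv ℝ (T.map K) x w =
      ∑ v, fderiv ℝ ((T.kind K).shape ν v) x w • T.node (T.vert K v) := by
  have hd : ∀ v, HasFDerivAt ((T.kind K).shape ν v) (fderiv ℝ ((T.kind K).shape ν v) x) x :=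
    fun v => (((RefCell.shape_contDiff _ v).differentiable two_ne_zero) x).hasFDerivAt
  have h1 : HasFDerivAt (T.map K)
      (∑ v, (fderiv ℝ ((T.kind K).shape ν v) x).smulRight (T.node (T.vert K v))) x := by
    unfold map
    exact HasFDerivAt.fun_sum fun v _ => (hd v).smul_const _
  rw [h1.fderiv]
  simp

section QuasiUniform

variable {h σ : ℝ}

theorem QuasiUniform.dist_le (hq : T.QuasiUniform h σ) (K : Fin T.nCell) {p q : Pt ν}
    (hp : p ∈ T.cell K) (hq' : q ∈ T.cell K) : dist p q ≤ σ * h :=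
  (Metric.dist_le_diam_of_mem (cell_isCompact K).isBounded hp hq').trans (hq K).1

/-- The centre `c` of the inscribed ball and `c + u` both lie in the tangent cell; their preimages
are points of the reference cell, hence at sup distance at most 1, and their difference is mapped to
`u`. -/
theorem QuasiUniform.exists_fderiv_eq (hh : 0 < h) (hσ : 0 < σ) (hq : T.QuasiUniform h σ)
    (K : Fin T.nCell) {x : Fin ν → ℝ} (hx : x ∈ (T.kind K).body ν) {u : Pt ν}
    (hu : ‖u‖ ≤ h / σ) : ∃ w, ‖w‖ ≤ 1 ∧ fderiv ℝ (T.map K) x w = u := by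
  obtain ⟨c, hc⟩ := (hq K).2 x hx
  obtain ⟨y, hy, hy'⟩ := hc (Metric.mem_closedBall_self (by positivity))
  obtain ⟨z, hz, hz'⟩ := hc (show c + u ∈ Metric.closedBall c (h / σ) by simpa using hu)
  refine ⟨z - y, RefCell.norm_sub_le_one _ hz hy, ?_⟩
  simp only at hy' hz'
  have : z - y = (z - x) - (y - x) := by abel
  rw [this, map_sub]
  have h1 := hz'.trans (congrArg (· + u) hy'.symm)
  simp only [add_assoc, add_right_inj] at h1
  rw [h1]
  abel

theorem QuasiUniform.fderiv_bijective (hh : 0 < h) (hσ : 0 < σ) (hq : T.QuasiUniform h σ)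
    (K : Fin T.nCell) {x : Fin ν → ℝ} (hx : x ∈ (T.kind K).body ν) :
    Function.Bijective (fderiv ℝ (T.map K) x) := by
  have hsurj : Function.Surjective (fderiv ℝ (T.map K) x).toLinearMap := by
    intro u
    by_cases hu : u = 0
    · exact ⟨0, by simp [hu]⟩
    have hu' : 0 < ‖u‖ := norm_pos_iff.2 hu
    obtain ⟨w, -, hw⟩ := hq.exists_fderiv_eq hh hσ K hx (u := (h / σ / ‖u‖) • u) (by
      rw [norm_smul, Real.norm_of_nonneg (by positivity)]
      exact (div_mul_cancel₀ _ hu'.ne').le)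
    refine ⟨(h / σ / ‖u‖)⁻¹ • w, ?_⟩
    rw [ContinuousLinearMap.coe_coe, map_smul, hw, smul_smul, inv_mul_cancel₀ (by positivity),
      one_smul]
  exact ⟨(LinearMap.injective_iff_surjective_of_finrank_eq_finrank (by simp)).2 hsurj, hsurj⟩

/-- The tangent maps expand lengths by at least `h / σ`. -/
theorem QuasiUniform.le_norm_fderiv (hh : 0 < h) (hσ : 0 < σ) (hq : T.QuasiUniform h σ)
    (K : Fin T.nCell) {x : Fin ν → ℝ} (hx : x ∈ (T.kind K).body ν) (w : Fin ν → ℝ) :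
    h / σ * ‖w‖ ≤ ‖fderiv ℝ (T.map K) x w‖ := by
  have hinj := (hq.fderiv_bijective hh hσ K hx).1
  by_cases hw : w = 0
  · simp [hw]
  have hu : 0 < ‖fderiv ℝ (T.map K) x w‖ := by
    rw [norm_pos_iff]
    intro h0
    exact hw (hinj (by rw [h0, map_zero]))
  set s := h / σ / ‖fderiv ℝ (T.map K) x w‖ with hs
  have hs0 : 0 < s := by positivity
  obtain ⟨w', hw', hw''⟩ := hq.exists_fderiv_eq hh hσ K hx (u := s • fderiv ℝ (T.map K) x w) (by
    rw [norm_smul, Real.norm_of_nonneg hs0.le]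
    exact (div_mul_cancel₀ _ hu.ne').le)
  rw [← map_smul] at hw''
  rw [hinj hw'', norm_smul, Real.norm_of_nonneg hs0.le, hs, div_mul_eq_mul_div,
    div_le_one hu] at hw'
  exact hw'

/-- A bijective derivative of an element map, as a continuous linear equivalence. -/
noncomputable def tangentEquiv (K : Fin T.nCell) (x : Fin ν → ℝ)
    (hb : Function.Bijective (fderiv ℝ (T.map K) x)) : (Fin ν → ℝ) ≃L[ℝ] Pt ν :=
  (LinearEquiv.ofBijective (fderiv ℝ (T.map K) x).toLinearMap hb).toContinuousLinearEquiv

theorem QuasiUniform.map_interior_subset (hh : 0 < h) (hσ : 0 < σ) (hq : T.QuasiUniform h σ)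
    (K : Fin T.nCell) {x : Fin ν → ℝ} (hx : x ∈ interior ((T.kind K).body ν)) :
    T.map K x ∈ interior (T.cell K) := by
  have hb := hq.fderiv_bijective hh hσ K (interior_subset hx)
  have h1 : HasStrictFDerivAt (T.map K) (tangentEquiv K x hb : (Fin ν → ℝ) →L[ℝ] Pt ν) x := by
    have heq : (tangentEquiv K x hb : (Fin ν → ℝ) →L[ℝ] Pt ν) = fderiv ℝ (T.map K) x := rfl
    rw [heq]
    exact (map_contDiff (T := T) K).contDiffAt.hasStrictFDerivAt two_ne_zero
  rw [mem_interior_iff_mem_nhds, ← h1.map_nhds_eq_of_equiv]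
  exact Filter.image_mem_map (mem_interior_iff_mem_nhds.1 hx)

theorem QuasiUniform.node_mem_closure (hν : 0 < ν) (hh : 0 < h) (hσ : 0 < σ)
    (hq : T.QuasiUniform h σ) (K : Fin T.nCell) (v : (T.kind K).Vertex ν) :
    T.node (T.vert K v) ∈ closure (interior (T.cell K)) := by
  have hne : (interior ((T.kind K).body ν)).Nonempty :=
    ⟨RefCell.centre ν, interior_mono (RefCell.closedBall_centre_subset hν _)
      (Metric.ball_subset_interior_closedBall (Metric.mem_ball_self (by positivity)))⟩
  have h1 := subset_closure (RefCell.vertexPt_mem (T.kind K) v)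
  rw [← (RefCell.body_convex (T.kind K)).closure_interior_eq_closure_of_nonempty_interior hne]
    at h1
  rw [← map_vertexPt]
  refine map_mem_closure (map_continuous K) h1 ?_
  exact fun x hx => hq.map_interior_subset hh hσ K hx

variable {m L : ℝ}

/-- The element maps are uniformly close to their linearizations. -/
theorem QuasiUniform.norm_map_sub_le (hL : 0 < L) (hb : RefCell.ShapeBounds ν m L)
    (hh : 0 < h) (hσ : 0 < σ)
    (hq : T.QuasiUniform h σ) (K : Fin T.nCell) {x₀ x y : Fin ν → ℝ}
    (hx₀ : x₀ ∈ (T.kind K).body ν) {ε : ℝ} (hε : 0 ≤ ε)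
    (hx : x ∈ (T.kind K).body ν ∩ Metric.closedBall x₀ ε)
    (hy : y ∈ (T.kind K).body ν ∩ Metric.closedBall x₀ ε) :
    ‖T.map K x - T.map K y - fderiv ℝ (T.map K) x₀ (x - y)‖
      ≤ m * L * σ * h * ε * ‖x - y‖ := by
  rcases isEmpty_or_nonempty ((T.kind K).Vertex ν) with hE | ⟨⟨v₀⟩⟩
  · have := RefCell.sum_shape (T.kind K) x₀
    simp at this
  set q : (T.kind K).Vertex ν → ℝ := fun v => (T.kind K).shape ν v x - (T.kind K).shape ν v y -
    fderiv ℝ ((T.kind K).shape ν v) x₀ (x - y) with hqdef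
  have hfd : ∑ v, fderiv ℝ ((T.kind K).shape ν v) x₀ (x - y) = 0 := by
    have h1 : HasFDerivAt (fun x => ∑ v, (T.kind K).shape ν v x)
        (∑ v, fderiv ℝ ((T.kind K).shape ν v) x₀) x₀ :=
      HasFDerivAt.fun_sum fun v _ =>
        (((RefCell.shape_contDiff _ v).differentiable two_ne_zero) x₀).hasFDerivAt
    have h2 : (fun x => ∑ v, (T.kind K).shape ν v x) = fun _ => 1 :=
      funext fun x => RefCell.sum_shape _ x
    rw [h2] at h1
    have h3 := h1.unique (hasFDerivAt_const 1 x₀)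
    have := congrArg (fun A => A (x - y)) h3
    simpa using this
  -- Since the shape functions sum to 1, the errors `q` sum to 0. The node `v₀` may thus be
  -- subtracted from every node, and only node differences, at most `σ h`, enter the bound.
  have hq0 : ∑ v, q v = 0 := by
    simp only [hqdef, Finset.sum_sub_distrib, RefCell.sum_shape, hfd]
    norm_num
  have h1 : T.map K x - T.map K y - fderiv ℝ (T.map K) x₀ (x - y) =
      ∑ v, q v • (T.node (T.vert K v) - T.node (T.vert K v₀)) := by
    simp only [smul_sub, Finset.sum_sub_distrib, ← Finset.sum_smul, hq0, zero_smul, sub_zero]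
    rw [fderiv_map_apply]
    simp only [map, hqdef, sub_smul, Finset.sum_sub_distrib]
  rw [h1]
  calc ‖∑ v, q v • (T.node (T.vert K v) - T.node (T.vert K v₀))‖
      ≤ ∑ v : (T.kind K).Vertex ν, L * ε * ‖x - y‖ * (σ * h) := by
        refine norm_sum_le_of_le _ fun v _ => ?_
        rw [norm_smul, ← dist_eq_norm]
        gcongr
        · exact ((hb _).2 v).2 x₀ hx₀ ε hε x hx y hy
        · exact hq.dist_le K (node_mem_cell K v) (node_mem_cell K v₀)
    _ = Fintype.card ((T.kind K).Vertex ν) * (L * ε * ‖x - y‖ * (σ * h)) := by simp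
    _ ≤ m * (L * ε * ‖x - y‖ * (σ * h)) := by
        gcongr
        exact (hb _).1
    _ = _ := by ring

/-- Near each point the element maps expand lengths. -/
theorem QuasiUniform.le_dist_map (hL : 0 < L) (hb : RefCell.ShapeBounds ν m L)
    (hh : 0 < h) (hσ : 0 < σ)
    (hq : T.QuasiUniform h σ) (K : Fin T.nCell) {x₀ x y : Fin ν → ℝ}
    (hx₀ : x₀ ∈ (T.kind K).body ν) {ε : ℝ} (hε : 0 ≤ ε) (hε' : 2 * m * L * σ ^ 2 * ε ≤ 1)
    (hx : x ∈ (T.kind K).body ν ∩ Metric.closedBall x₀ ε)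
    (hy : y ∈ (T.kind K).body ν ∩ Metric.closedBall x₀ ε) :
    h / (2 * σ) * ‖x - y‖ ≤ ‖T.map K x - T.map K y‖ := by
  have h1 := hq.norm_map_sub_le hL hb hh hσ K hx₀ hε hx hy
  have h2 := hq.le_norm_fderiv hh hσ K hx₀ (x - y)
  have h3 := norm_sub_norm_le (fderiv ℝ (T.map K) x₀ (x - y)) (T.map K x - T.map K y)
  rw [norm_sub_rev _ (T.map K x - T.map K y)] at h3
  -- The condition on `ε` makes the linearization error at most half of the expansion `h / σ` of the
  -- tangent map.
  have h4 : m * L * σ * h * ε ≤ h / (2 * σ) := by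
    rw [le_div_iff₀ (by positivity)]
    calc m * L * σ * h * ε * (2 * σ) = h * (2 * m * L * σ ^ 2 * ε) := by ring
      _ ≤ h * 1 := by gcongr
      _ = h := mul_one h
  have h5 : m * L * σ * h * ε * ‖x - y‖ ≤ h / (2 * σ) * ‖x - y‖ := by gcongr
  have h6 : h / σ * ‖x - y‖ = 2 * (h / (2 * σ) * ‖x - y‖) := by
    field_simp
  linarith

/-- Every cell contains a ball whose radius is comparable to the mesh size. -/
theorem QuasiUniform.exists_ball_subset (hν : 0 < ν) (hm : 0 < m) (hL : 0 < L)
    (hb : RefCell.ShapeBounds ν m L) (hh : 0 < h) (hσ : 0 < σ)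
    (hq : T.QuasiUniform h σ) (K : Fin T.nCell) {ε : ℝ} (hε : 0 ≤ ε)
    (hε' : 2 * m * L * σ ^ 2 * ε ≤ 1) (hε'' : ε ≤ (2 * ν : ℝ)⁻¹) :
    ∃ c : Pt ν, Metric.closedBall c (h / (2 * σ) * ε) ⊆ T.cell K := by
  have hsub : Metric.closedBall (RefCell.centre ν) ε ⊆ (T.kind K).body ν :=
    (Metric.closedBall_subset_closedBall hε'').trans (RefCell.closedBall_centre_subset hν _)
  have hc : RefCell.centre ν ∈ (T.kind K).body ν := hsub (Metric.mem_closedBall_self hε)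
  have hbij := hq.fderiv_bijective hh hσ K hc
  have happ : ApproximatesLinearOn (T.map K) (fderiv ℝ (T.map K) (RefCell.centre ν))
      (Metric.closedBall (RefCell.centre ν) ε) ⟨m * L * σ * h * ε, by positivity⟩ := by
    exact fun x hx y hy => hq.norm_map_sub_le hL hb hh hσ K hc hε ⟨hsub hx, hx⟩ ⟨hsub hy, hy⟩
  let e := tangentEquiv K _ hbij
  -- The inverse of the tangent map has norm at most `σ / h`. By the quantitative inverse function
  -- theorem the image of the `ε`-ball contains a ball of radius `(h / σ - error) * ε`, and the
  -- error is at most `h / (2 * σ)`.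
  let g : (fderiv ℝ (T.map K) (RefCell.centre ν)).NonlinearRightInverse :=
    { toFun := e.symm
      nnnorm := ⟨σ / h, by positivity⟩
      bound' := by
        intro y
        have h1 := hq.le_norm_fderiv hh hσ K hc (e.symm y)
        have h2 : fderiv ℝ (T.map K) (RefCell.centre ν) (e.symm y) = y := e.apply_symm_apply y
        rw [h2] at h1
        change _ ≤ σ / h * ‖y‖
        calc ‖e.symm y‖ = σ / h * (h / σ * ‖e.symm y‖) := by field_simp
          _ ≤ _ := by gcongr
      right_inv' := fun y => e.apply_symm_apply y }
  have h1 := happ.surjOn_closedBall_of_nonlinearRightInverse g hε subset_rfl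
  refine ⟨T.map K (RefCell.centre ν), ?_⟩
  refine (Metric.closedBall_subset_closedBall ?_).trans (h1.trans (Set.image_mono hsub))
  gcongr
  change h / (2 * σ) ≤ (σ / h)⁻¹ - m * L * σ * h * ε
  have h4 : m * L * σ * h * ε ≤ h / (2 * σ) := by
    rw [le_div_iff₀ (by positivity)]
    calc m * L * σ * h * ε * (2 * σ) = h * (2 * m * L * σ ^ 2 * ε) := by ring
      _ ≤ h * 1 := by gcongr
      _ = h := mul_one h
  have h6 : (σ / h)⁻¹ = 2 * (h / (2 * σ)) := by
    field_simp
  linarith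

open Classical in
/-- The number of cells containing a given point is bounded. -/
theorem QuasiUniform.card_cells_le (hν : 0 < ν) (hm : 0 < m) (hL : 0 < L)
    (hb : RefCell.ShapeBounds ν m L) (hh : 0 < h) (hσ : 0 < σ)
    (hT : T.Conforming) (hq : T.QuasiUniform h σ) {ε : ℝ} (hε : 0 < ε)
    (hε' : 2 * m * L * σ ^ 2 * ε ≤ 1) (hε'' : ε ≤ (2 * ν : ℝ)⁻¹) (p : Pt ν) :
    ((Finset.univ.filter fun K => p ∈ T.cell K).card : ℝ) ≤ (2 * σ ^ 2 / ε) ^ ν := by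
  choose c hc using fun K => hq.exists_ball_subset hν hm hL hb hh hσ K hε.le hε' hε''
  set ρ := h / (2 * σ) * ε with hρ
  have hρ0 : 0 < ρ := by positivity
  set S := Finset.univ.filter fun K => p ∈ T.cell K with hS
  have h1 : ∀ K, Metric.ball (c K) ρ ⊆ interior (T.cell K) := fun K =>
    interior_maximal (Metric.ball_subset_closedBall.trans (hc K)) Metric.isOpen_ball
  have hdisj : (S : Set (Fin T.nCell)).PairwiseDisjoint fun K => Metric.ball (c K) ρ :=
    fun K _ K' _ hne => (hT.interior_disjoint K K' hne).mono (h1 K) (h1 K')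
  -- Packing: the cells through `p` contain disjoint balls of radius `ρ` inside the ball of radius
  -- `σ h` about `p`, so their number is at most `(σ h / ρ) ^ ν`.
  have h2 : volume (⋃ K ∈ S, Metric.ball (c K) ρ) ≤ volume (Metric.closedBall p (σ * h)) := by
    refine measure_mono (Set.iUnion₂_subset fun K hK q hq' => ?_)
    exact hq.dist_le K (interior_subset (h1 K hq')) (Finset.mem_filter.1 hK).2
  rw [measure_biUnion_finset hdisj fun K _ => Metric.isOpen_ball.measurableSet] at h2
  have hB : volume (Metric.ball (0 : Pt ν) 1) ≠ 0 := (Metric.measure_ball_pos _ _ one_pos).ne'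
  have hB' : volume (Metric.ball (0 : Pt ν) 1) ≠ ⊤ := measure_ball_lt_top.ne
  simp only [Measure.addHaar_ball_of_pos _ _ hρ0, Measure.addHaar_closedBall _ _
    (show 0 ≤ σ * h by positivity), Finset.sum_const, nsmul_eq_mul, finrank_euclideanSpace,
    Fintype.card_fin] at h2
  rw [← mul_assoc, ENNReal.mul_le_mul_iff_left hB hB', ← ENNReal.ofReal_natCast,
    ← ENNReal.ofReal_mul (by positivity), ENNReal.ofReal_le_ofReal_iff (by positivity)] at h2
  rw [← le_div_iff₀ (by positivity), ← div_pow] at h2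
  refine h2.trans (le_of_eq ?_)
  congr 1
  rw [hρ]
  field_simp

end QuasiUniform

/-! ### Finite element functions and their volume norms. -/

theorem basis_of_notMem (r : Fin T.nNode) {p : Pt ν} (hp : ∀ K, p ∉ T.cell K) :
    T.basis r p = 0 := by
  rw [basis, dif_neg]
  rintro ⟨K, x, hx, rfl⟩
  exact hp K (map_mem_cell K hx)

theorem localBasis_continuous (K : Fin T.nCell) (r : Fin T.nNode) :
    Continuous (T.localBasis K r) := by
  unfold localBasis
  refine continuous_finsetSum _ fun v _ => ?_
  split_ifs
  · exact RefCell.shape_continuous _ v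
  · exact continuous_const

theorem localBasis_nonneg (K : Fin T.nCell) (r : Fin T.nNode) {x : Fin ν → ℝ}
    (hx : x ∈ (T.kind K).body ν) : 0 ≤ T.localBasis K r x := by
  refine Finset.sum_nonneg fun v _ => ?_
  split_ifs
  · exact RefCell.shape_nonneg _ v hx
  · exact le_rfl

theorem sum_mul_localBasis (K : Fin T.nCell) (c : Fin T.nNode → ℝ) (x : Fin ν → ℝ) :
    ∑ r, c r * T.localBasis K r x = ∑ v, c (T.vert K v) * (T.kind K).shape ν v x := by
  simp only [localBasis, Finset.mul_sum]
  rw [Finset.sum_comm]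
  simp

/-- The finite element function with nodal coefficients `c`. -/
noncomputable def fe (T : Mesh ν) (c : Fin T.nNode → ℝ) (p : Pt ν) : ℝ :=
  ∑ r, c r * T.basis r p

namespace Conforming

theorem basis_nonneg (hT : T.Conforming) (r : Fin T.nNode) (p : Pt ν) : 0 ≤ T.basis r p := by
  by_cases hp : ∃ K, p ∈ T.cell K
  · obtain ⟨K, x, hx, rfl⟩ := hp
    rw [T.basis_map hT r K x hx]
    exact localBasis_nonneg K r hx
  · rw [basis_of_notMem r (not_exists.1 hp)]

theorem fe_map (hT : T.Conforming) (c : Fin T.nNode → ℝ) (K : Fin T.nCell) {x : Fin ν → ℝ}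
    (hx : x ∈ (T.kind K).body ν) :
    T.fe c (T.map K x) = ∑ v, c (T.vert K v) * (T.kind K).shape ν v x := by
  simp only [fe, T.basis_map hT _ K x hx, sum_mul_localBasis]

theorem fe_node (hT : T.Conforming) (c : Fin T.nNode → ℝ) (r : Fin T.nNode) :
    T.fe c (T.node r) = c r := by
  obtain ⟨K, v, rfl⟩ := hT.node_mem r
  rw [← map_vertexPt, fe_map hT c K (RefCell.vertexPt_mem _ v), Fintype.sum_eq_single v]
  · rw [RefCell.shape_vertexPt, mul_one]
  · intro w hw
    rw [RefCell.shape_vertexPt_of_ne _ hw, mul_zero]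

theorem sum_basis_le_one (hT : T.Conforming) (p : Pt ν) : ∑ r, T.basis r p ≤ 1 := by
  by_cases hp : ∃ K, p ∈ T.cell K
  · obtain ⟨K, x, hx, rfl⟩ := hp
    have := fe_map hT (fun _ => 1) K hx
    simp only [fe, one_mul, RefCell.sum_shape] at this
    exact this.le
  · simp [basis_of_notMem _ (not_exists.1 hp)]

theorem basis_le_one (hT : T.Conforming) (r : Fin T.nNode) (p : Pt ν) : T.basis r p ≤ 1 :=
  (Finset.single_le_sum (fun s _ => hT.basis_nonneg s p) (Finset.mem_univ r)).trans
    (hT.sum_basis_le_one p)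

/-- The preimage of a closed set is a finite union of compact images of pieces of reference cells,
together with the complement of the mesh when the set contains 0. -/
theorem basis_measurable (hT : T.Conforming) (r : Fin T.nNode) : Measurable (T.basis r) := by
  have hclosed : ∀ C : Set ℝ, IsClosed C →
      IsClosed (⋃ K, T.map K '' ((T.kind K).body ν ∩ T.localBasis K r ⁻¹' C)) := by
    intro C hC
    refine isClosed_iUnion_of_finite fun K => IsCompact.isClosed ?_
    refine IsCompact.image ?_ (map_continuous K)
    exact (RefCell.body_isCompact _).inter_right (hC.preimage (localBasis_continuous K r))
  refine measurable_of_isClosed fun C hC => ?_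
  have h1 : T.basis r ⁻¹' C =
      (⋃ K, T.map K '' ((T.kind K).body ν ∩ T.localBasis K r ⁻¹' C)) ∪
        {p | p ∉ (⋃ K, T.cell K) ∧ (0 : ℝ) ∈ C} := by
    ext p
    by_cases hp : ∃ K, p ∈ T.cell K
    · simp only [Set.mem_preimage, Set.mem_union, Set.mem_iUnion, Set.mem_ofPred_eq, hp,
        not_true, false_and, or_false]
      constructor
      · intro hpC
        obtain ⟨K, x, hx, rfl⟩ := hp
        refine ⟨K, x, ⟨hx, ?_⟩, rfl⟩
        rwa [Set.mem_preimage, ← T.basis_map hT r K x hx]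
      · rintro ⟨K, x, ⟨hx, hxC⟩, rfl⟩
        rwa [T.basis_map hT r K x hx]
    · have h0 : ¬ ∃ K, p ∈ T.map K '' ((T.kind K).body ν ∩ T.localBasis K r ⁻¹' C) := by
        rintro ⟨K, hK⟩
        exact hp ⟨K, Set.image_mono Set.inter_subset_left hK⟩
      simp only [Set.mem_preimage, Set.mem_union, Set.mem_iUnion, Set.mem_ofPred_eq, hp, h0,
        basis_of_notMem r (not_exists.1 hp)]
      simp
  rw [h1]
  refine (hclosed C hC).measurableSet.union ?_
  have h2 : MeasurableSet (⋃ K, T.cell K) :=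
    MeasurableSet.iUnion fun K => (cell_isCompact K).isClosed.measurableSet
  by_cases h0 : (0 : ℝ) ∈ C
  · simpa [h0, Set.compl_def] using h2.compl
  · simp [h0]

theorem fe_measurable (hT : T.Conforming) (c : Fin T.nNode → ℝ) : Measurable (T.fe c) := by
  unfold fe
  exact Finset.measurable_sum _ fun r _ => (hT.basis_measurable r).const_mul _

theorem abs_fe_le (hT : T.Conforming) (c : Fin T.nNode → ℝ) (p : Pt ν) :
    |T.fe c p| ≤ ∑ r, |c r| := by
  refine (Finset.abs_sum_le_sum_abs _ _).trans (Finset.sum_le_sum fun r _ => ?_)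
  rw [abs_mul, abs_of_nonneg (hT.basis_nonneg r p)]
  exact mul_le_of_le_one_right (abs_nonneg _) (hT.basis_le_one r p)

/-- Products of finite element functions are integrable against finite measures. -/
theorem integrable_fe_mul (hT : T.Conforming) {T' : Mesh ν} (hT' : T'.Conforming)
    (c : Fin T.nNode → ℝ)
    (c' : Fin T'.nNode → ℝ) (μ : Measure (Pt ν)) [IsFiniteMeasure μ] :
    Integrable (fun p => T.fe c p * T'.fe c' p) μ := by
  refine Integrable.of_bound (C := (∑ r, |c r|) * ∑ r, |c' r|)
    ((hT.fe_measurable c).mul (hT'.fe_measurable c')).aestronglyMeasurable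
    (Filter.Eventually.of_forall fun p => ?_)
  rw [norm_mul]
  have := hT.abs_fe_le c p
  have := hT'.abs_fe_le c' p
  simp only [Real.norm_eq_abs]
  gcongr

/-- Cauchy–Schwarz with the basis functions as weights of total mass at most 1. It removes the
off-diagonal terms from the mass form. -/
theorem fe_sq_le (hT : T.Conforming) (c : Fin T.nNode → ℝ) (p : Pt ν) :
    T.fe c p ^ 2 ≤ ∑ r, c r ^ 2 * T.basis r p := by
  have h1 := Finset.sum_mul_sq_le_sq_mul_sq Finset.univ
    (fun r => c r * Real.sqrt (T.basis r p)) (fun r => Real.sqrt (T.basis r p))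
  have h2 : ∀ r, Real.sqrt (T.basis r p) ^ 2 = T.basis r p := fun r =>
    Real.sq_sqrt (hT.basis_nonneg r p)
  simp only [mul_pow, h2, mul_assoc, Real.mul_self_sqrt (hT.basis_nonneg _ p)] at h1
  refine h1.trans (mul_le_of_le_one_right ?_ (hT.sum_basis_le_one p))
  exact Finset.sum_nonneg fun r _ => mul_nonneg (sq_nonneg _) (hT.basis_nonneg r p)

/-- The pullback to the compact reference cell is continuous, and a continuous map from a compact
set onto the cell is a quotient map. -/
theorem fe_continuousOn_cell (hT : T.Conforming) (c : Fin T.nNode → ℝ) (K : Fin T.nCell) :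
    ContinuousOn (T.fe c) (T.cell K) := by
  rw [continuousOn_iff_isClosed]
  intro C hC
  refine ⟨T.map K '' ((T.kind K).body ν ∩
    (fun x => ∑ v, c (T.vert K v) * (T.kind K).shape ν v x) ⁻¹' C), ?_, ?_⟩
  · refine IsCompact.isClosed (IsCompact.image ?_ (map_continuous K))
    refine (RefCell.body_isCompact _).inter_right (hC.preimage ?_)
    exact continuous_finsetSum _ fun v _ => continuous_const.mul (RefCell.shape_continuous _ v)
  · ext p
    constructor
    · rintro ⟨hp, x, hx, rfl⟩
      refine ⟨⟨x, ⟨hx, ?_⟩, rfl⟩, ⟨x, hx, rfl⟩⟩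
      rw [Set.mem_preimage, ← hT.fe_map c K hx]
      exact hp
    · rintro ⟨⟨x, ⟨hx, hxC⟩, rfl⟩, hp⟩
      refine ⟨?_, hp⟩
      rw [Set.mem_preimage, hT.fe_map c K hx]
      exact hxC

variable {h σ : ℝ}

/-- Wherever the basis function is nonzero, the point shares a cell with the node, so their distance
is at most a cell diameter. -/
theorem basis_le_indicator (hT : T.Conforming) (hq : T.QuasiUniform h σ) (r : Fin T.nNode)
    (p : Pt ν) :
    T.basis r p ≤ (Metric.closedBall (T.node r) (σ * h)).indicator 1 p := by
  by_cases h0 : T.basis r p = 0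
  · rw [h0]
    exact Set.indicator_nonneg (fun _ _ => zero_le_one) _
  · have hp : ∃ K, p ∈ T.cell K := by
      by_contra hp
      exact h0 (basis_of_notMem r (not_exists.1 hp))
    obtain ⟨K, x, hx, rfl⟩ := hp
    have h1 := h0
    rw [T.basis_map hT r K x hx, localBasis] at h1
    obtain ⟨v, -, hv⟩ := Finset.exists_ne_zero_of_sum_ne_zero h1
    rw [ite_ne_right_iff] at hv
    obtain ⟨rfl, -⟩ := hv
    rw [Set.indicator_of_mem]
    · exact hT.basis_le_one _ _
    · exact hq.dist_le K (map_mem_cell K hx) (node_mem_cell K v)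

end Conforming

theorem region_isOpen : IsOpen T.region := isOpen_interior

theorem volume_region_lt_top : volume T.region < ⊤ :=
  (measure_mono interior_subset).trans_lt
    (isCompact_iUnion fun K => cell_isCompact K).measure_lt_top

instance : IsFiniteMeasure (volume.restrict T.region) :=
  ⟨by rw [Measure.restrict_apply_univ]; exact volume_region_lt_top⟩

theorem interior_cell_subset_region (K : Fin T.nCell) : interior (T.cell K) ⊆ T.region :=
  interior_mono (Set.subset_iUnion T.cell K)

namespace Conforming

variable {h σ : ℝ}

theorem setIntegral_region_fe_sq_le (hT : T.Conforming) (hh : 0 < h) (hσ : 0 < σ)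
    (hq : T.QuasiUniform h σ)
    (c : Fin T.nNode → ℝ) :
    ∫ p in T.region, T.fe c p ^ 2 ≤
      (σ * h) ^ ν * volume.real (Metric.ball (0 : Pt ν) 1) * ∑ r, c r ^ 2 := by
  have hind : ∀ r, Integrable (fun p => c r ^ 2 *
      (Metric.closedBall (T.node r) (σ * h)).indicator (1 : Pt ν → ℝ) p) := by
    intro r
    refine Integrable.const_mul ?_ _
    exact (integrable_indicator_iff Metric.isClosed_closedBall.measurableSet).2
      (integrableOn_const (by exact measure_closedBall_lt_top.ne))
  have hint : Integrable (fun p => ∑ r, c r ^ 2 *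
      (Metric.closedBall (T.node r) (σ * h)).indicator (1 : Pt ν → ℝ) p) :=
    integrable_finsetSum _ fun r _ => hind r
  have hnn : ∀ p, 0 ≤ ∑ r, c r ^ 2 *
      (Metric.closedBall (T.node r) (σ * h)).indicator (1 : Pt ν → ℝ) p := fun p =>
    Finset.sum_nonneg fun r _ => mul_nonneg (sq_nonneg _)
      (Set.indicator_nonneg (fun _ _ => zero_le_one) _)
  calc ∫ p in T.region, T.fe c p ^ 2
      ≤ ∫ p in T.region, ∑ r, c r ^ 2 *
          (Metric.closedBall (T.node r) (σ * h)).indicator (1 : Pt ν → ℝ) p := by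
        refine integral_mono_of_nonneg (Filter.Eventually.of_forall fun p => sq_nonneg _)
          hint.integrableOn (Filter.Eventually.of_forall fun p => ?_)
        refine (hT.fe_sq_le c p).trans (Finset.sum_le_sum fun r _ => ?_)
        exact mul_le_mul_of_nonneg_left (hT.basis_le_indicator hq r p) (sq_nonneg _)
    _ ≤ ∫ p, ∑ r, c r ^ 2 *
          (Metric.closedBall (T.node r) (σ * h)).indicator (1 : Pt ν → ℝ) p :=
        setIntegral_le_integral hint (Filter.Eventually.of_forall hnn)
    _ = _ := by
        rw [integral_finsetSum _ fun r _ => hind r, Finset.mul_sum]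
        refine Finset.sum_congr rfl fun r _ => ?_
        rw [integral_const_mul, integral_indicator_one Metric.isClosed_closedBall.measurableSet,
          Measure.real, Measure.addHaar_closedBall _ _ (by positivity), ENNReal.toReal_mul,
          ENNReal.toReal_ofReal (by positivity), finrank_euclideanSpace, Fintype.card_fin, mul_comm]
        rfl

/-- The full mass matrix is definite. -/
theorem eq_zero_of_setIntegral_fe_sq (hT : T.Conforming) (hν : 0 < ν) (hh : 0 < h) (hσ : 0 < σ)
    (hq : T.QuasiUniform h σ) (c : Fin T.nNode → ℝ)
    (h0 : ∫ p in T.region, T.fe c p ^ 2 = 0) : c = 0 := by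
  have hint : Integrable (fun p => T.fe c p ^ 2) (volume.restrict T.region) := by
    simpa only [sq] using hT.integrable_fe_mul hT c c (volume.restrict T.region)
  rw [integral_eq_zero_iff_of_nonneg (fun p => sq_nonneg _) hint] at h0
  funext r
  obtain ⟨K, v, rfl⟩ := hT.node_mem r
  have h1 : T.fe c =ᵐ[volume.restrict (interior (T.cell K))] fun _ => 0 := by
    filter_upwards [ae_restrict_of_ae_restrict_of_subset (interior_cell_subset_region K) h0]
      with p hp
    simpa using hp
  -- Vanishing a.e. on the open interior of a cell becomes vanishing everywhere there by continuity,
  -- and then extends to the closure, which contains the vertices.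
  have h2 := Measure.eqOn_open_of_ae_eq h1 isOpen_interior
    ((hT.fe_continuousOn_cell c K).mono interior_subset) continuousOn_const
  rw [← hT.fe_node c]
  have h4 : (closure (interior (T.cell K))) ⊆ T.cell K :=
    closure_minimal interior_subset (cell_isCompact K).isClosed
  exact (h2.of_subset_closure ((hT.fe_continuousOn_cell c K).mono h4) continuousOn_const
    subset_closure subset_rfl) (hq.node_mem_closure hν hh hσ K v)

end Conforming

end Mesh

/-! ### Surface measure and `L²` norms on facets. -/

/-- Maps which expand distances by a factor `k` on a set increase its `d`-dimensional Hausdorff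
measure by at least `k ^ d`. -/
theorem ofReal_pow_mul_hausdorffMeasure_le {X Y : Type*} [MetricSpace X] [MeasurableSpace X]
    [BorelSpace X] [MetricSpace Y] [MeasurableSpace Y] [BorelSpace Y] (d : ℕ) {k : ℝ} (hk : 0 < k)
    {s : Set X} {ψ : X → Y} (hψ : ∀ x ∈ s, ∀ y ∈ s, k * dist x y ≤ dist (ψ x) (ψ y)) :
    ENNReal.ofReal k ^ d * μH[d] s ≤ μH[d] (ψ '' s) := by
  rcases s.eq_empty_or_nonempty with rfl | ⟨x₀, -⟩
  · simp
  have : Nonempty X := ⟨x₀⟩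
  have hinj : Set.InjOn ψ s := by
    intro x hx y hy hxy
    have h1 := hψ x hx y hy
    rw [hxy, dist_self] at h1
    exact dist_le_zero.1 (nonpos_of_mul_nonpos_right h1 hk)
  have hleft := hinj.leftInvOn_invFunOn
  have hlip : LipschitzOnWith (Real.toNNReal k⁻¹) (Function.invFunOn ψ s) (ψ '' s) := by
    refine LipschitzOnWith.of_dist_le_mul ?_
    rintro _ ⟨x, hx, rfl⟩ _ ⟨y, hy, rfl⟩
    rw [hleft hx, hleft hy, Real.coe_toNNReal _ (by positivity), inv_mul_eq_div,
      le_div_iff₀ hk, mul_comm]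
    exact hψ x hx y hy
  have h1 := hlip.hausdorffMeasure_image_le (d := d) (by positivity)
  rw [hleft.image_image] at h1
  calc ENNReal.ofReal k ^ d * μH[d] s
      ≤ ENNReal.ofReal k ^ d * ((Real.toNNReal k⁻¹ : ENNReal) ^ (d : ℝ) * μH[d] (ψ '' s)) := by
        gcongr
    _ = μH[d] (ψ '' s) := by
        rw [ENNReal.rpow_natCast, ← mul_assoc, ← mul_pow]
        change (ENNReal.ofReal k * ENNReal.ofReal k⁻¹) ^ d * _ = _
        rw [← ENNReal.ofReal_mul hk.le, mul_inv_cancel₀ hk.ne', ENNReal.ofReal_one, one_pow, one_mul]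

namespace Mesh

variable {n : ℕ} {T : Mesh (n + 1)}

theorem facet_image_isCompact (K : Fin T.nCell) {f : Set (Fin (n + 1) → ℝ)}
    (hf : f ∈ (T.kind K).facets (n + 1)) : IsCompact (T.map K '' f) :=
  (RefCell.facet_isCompact _ hf).image (map_continuous K)

/-- The facet is contained in a Lipschitz image of the unit cube of dimension `n`. -/
theorem facet_image_lt_top (K : Fin T.nCell) {f : Set (Fin (n + 1) → ℝ)}
    (hf : f ∈ (T.kind K).facets (n + 1)) : μHE[n] (T.map K '' f) < ⊤ := by
  obtain ⟨φ, hφ, -, -, hsub⟩ := RefCell.exists_facet_chart _ hf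
  have h1 : ContDiff ℝ 1 (T.map K ∘ φ) := ((map_contDiff K).of_le one_le_two).comp hφ
  obtain ⟨C, hC⟩ := h1.contDiffOn.exists_lipschitzOnWith one_ne_zero (convex_Icc 0 1) isCompact_Icc
  have h2 := hC.hausdorffMeasure_image_le (d := n) (by positivity)
  rw [Set.image_comp] at h2
  have h3 : (μH[(n : ℝ)] : Measure (Fin n → ℝ)) = volume := by
    have := hausdorffMeasure_pi_real (ι := Fin n)
    rwa [Fintype.card_fin] at this
  rw [h3] at h2
  rw [Measure.euclideanHausdorffMeasure_def, Measure.smul_apply, ENNReal.smul_def, smul_eq_mul]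
  refine ENNReal.mul_lt_top ENNReal.coe_lt_top ((measure_mono (Set.image_mono hsub)).trans_lt
    (h2.trans_lt ?_))
  exact ENNReal.mul_lt_top (ENNReal.rpow_lt_top_of_nonneg (by positivity) ENNReal.coe_ne_top)
    isCompact_Icc.measure_lt_top

namespace Conforming

variable {h σ m L ε : ℝ}

/-- On the part of a facet close to the vertex with the largest nodal value, a finite element
function is at least half as large as this value. -/
theorem half_le_abs_fe (hT : T.Conforming) (hL : 0 < L) (hb : RefCell.ShapeBounds (n + 1) m L)
    (hε : 0 < ε) (hε' : 2 * m * L * ε ≤ 1) (c : Fin T.nNode → ℝ)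
    (K : Fin T.nCell) {f : Set (Fin (n + 1) → ℝ)}
    (hf : f ∈ (T.kind K).facets (n + 1)) {v : (T.kind K).Vertex (n + 1)}
    (hv : (T.kind K).vertexPt (n + 1) v ∈ f)
    (hmax : ∀ w, (T.kind K).vertexPt (n + 1) w ∈ f → |c (T.vert K w)| ≤ |c (T.vert K v)|)
    {x : Fin (n + 1) → ℝ} (hx : x ∈ f) (hxv : ‖x - (T.kind K).vertexPt (n + 1) v‖ ≤ ε) :
    |c (T.vert K v)| / 2 ≤ |T.fe c (T.map K x)| := by
  have hsub := RefCell.facet_subset _ hf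
  have h1 : T.fe c (T.map K x) - c (T.vert K v) = ∑ w, c (T.vert K w) *
      ((T.kind K).shape _ w x - (T.kind K).shape _ w ((T.kind K).vertexPt _ v)) := by
    rw [← hT.fe_node c (T.vert K v), ← map_vertexPt, hT.fe_map c K (hsub hx),
      hT.fe_map c K (hsub hv), ← Finset.sum_sub_distrib]
    simp only [mul_sub]
  have h2 : |T.fe c (T.map K x) - c (T.vert K v)| ≤ |c (T.vert K v)| / 2 := by
    rw [h1]
    calc |∑ w, c (T.vert K w) *
          ((T.kind K).shape _ w x - (T.kind K).shape _ w ((T.kind K).vertexPt _ v))|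
        ≤ ∑ w : (T.kind K).Vertex (n + 1), |c (T.vert K v)| * (L * ε) := by
          refine (Finset.abs_sum_le_sum_abs _ _).trans (Finset.sum_le_sum fun w _ => ?_)
          rw [abs_mul]
          -- Vertices of the facet have nodal values bounded by the maximum; the other vertices,
          -- whose values are uncontrolled, contribute nothing on the facet.
          by_cases hw : (T.kind K).vertexPt (n + 1) w ∈ f
          · have := ((hb _).2 w).1 x (hsub hx) _ (hsub hv)
            have h3 := hmax w hw
            have : L * ‖x - (T.kind K).vertexPt (n + 1) v‖ ≤ L * ε := by gcongr
            gcongr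
            linarith
          · have hz : ∀ y ∈ f, (T.kind K).shape (n + 1) w y = 0 := fun y hy => by
              by_contra h0
              exact hw (RefCell.vertexPt_mem_facet _ hf hy h0)
            rw [hz x hx, hz _ hv]
            simp only [sub_self, abs_zero, mul_zero]
            positivity
      _ = Fintype.card ((T.kind K).Vertex (n + 1)) * (|c (T.vert K v)| * (L * ε)) := by simp
      _ ≤ m * (|c (T.vert K v)| * (L * ε)) := by
          gcongr
          exact (hb _).1
      _ = |c (T.vert K v)| / 2 * (2 * m * L * ε) := by ring
      _ ≤ |c (T.vert K v)| / 2 := mul_le_of_le_one_right (by positivity) hε'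
  have h3 := abs_sub_abs_le_abs_sub (c (T.vert K v)) (T.fe c (T.map K x))
  rw [abs_sub_comm] at h3
  linarith

/-- The `L²` norm on a facet controls the nodal values at its vertices. -/
theorem le_setIntegral_facet (hT : T.Conforming) (hL : 0 < L) (hb : RefCell.ShapeBounds (n + 1) m L)
    (hh : 0 < h) (hσ : 0 < σ) (hq : T.QuasiUniform h σ)
    (hε : 0 < ε) (hε1 : ε ≤ 1) (hε' : 2 * m * L * ε ≤ 1) (hε'' : 2 * m * L * σ ^ 2 * ε ≤ 1)
    (c : Fin T.nNode → ℝ) (K : Fin T.nCell) {f : Set (Fin (n + 1) → ℝ)}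
    (hf : f ∈ (T.kind K).facets (n + 1)) {v : (T.kind K).Vertex (n + 1)}
    (hv : (T.kind K).vertexPt (n + 1) v ∈ f) :
    (Measure.addHaarScalarFactor (volume : Measure (EuclideanSpace ℝ (Fin n))) μH[n] : ℝ) *
        (ε / (2 * σ * (n + 1))) ^ n / 4 * h ^ n * c (T.vert K v) ^ 2 ≤
      ∫ p in T.map K '' f, T.fe c p ^ 2 ∂μHE[n] := by
  classical
  -- It suffices to bound the integral below by the largest nodal value of the facet, attained at
  -- `w`.
  obtain ⟨w, hw, hmax⟩ := Finset.exists_max_image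
    (Finset.univ.filter fun w => (T.kind K).vertexPt (n + 1) w ∈ f) (fun w => |c (T.vert K w)|)
    ⟨v, by simpa using hv⟩
  simp only [Finset.mem_filter, Finset.mem_univ, true_and] at hw hmax
  obtain ⟨φ, hφ, hφf, hφe, -⟩ := RefCell.exists_facet_chart _ hf
  have hsub := RefCell.facet_subset _ hf
  set B : Set (Fin n → ℝ) := Set.Icc 0 (fun _ => ((n : ℝ) + 1)⁻¹) with hB
  set x₀ := (T.kind K).vertexPt (n + 1) w with hx₀
  -- The facet chart is shrunk towards the vertex by the factor `ε`: by convexity it stays in the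
  -- facet, and it stays within `ε` of the vertex, where the element map expands distances by `h /
  -- (2 * σ)`.
  let χ : (Fin n → ℝ) → (Fin (n + 1) → ℝ) := fun z => x₀ + ε • (φ z - x₀)
  have hχc : Continuous χ := by
    have := hφ.continuous
    fun_prop
  have hχf : ∀ z ∈ B, χ z ∈ f := fun z hz =>
    (RefCell.facet_convex _ hf).add_smul_sub_mem hw (hφf z hz) ⟨hε.le, hε1⟩
  have hχn : ∀ z ∈ B, ‖χ z - x₀‖ ≤ ε := by
    intro z hz
    simp only [χ, add_sub_cancel_left, norm_smul, Real.norm_of_nonneg hε.le]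
    exact mul_le_of_le_one_right hε.le
      (RefCell.norm_sub_le_one _ (hsub (hφf z hz)) (hsub hw))
  let ψ := T.map K ∘ χ
  have hψc : IsCompact (ψ '' B) := isCompact_Icc.image ((map_continuous K).comp hχc)
  have hψf : ψ '' B ⊆ T.map K '' f := by
    rintro _ ⟨z, hz, rfl⟩
    exact ⟨χ z, hχf z hz, rfl⟩
  have hψe : ∀ y ∈ B, ∀ z ∈ B, h / (2 * σ) * ε * dist y z ≤ dist (ψ y) (ψ z) := by
    intro y hy z hz
    have h1 := hq.le_dist_map hL hb hh hσ K (hsub hw) hε.le hε''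
      (x := χ y) (y := χ z) ⟨hsub (hχf y hy), by rw [mem_closedBall_iff_norm]; exact hχn y hy⟩
      ⟨hsub (hχf z hz), by rw [mem_closedBall_iff_norm]; exact hχn z hz⟩
    have h2 : χ y - χ z = ε • (φ y - φ z) := by
      simp only [χ, smul_sub]
      abel
    rw [h2, norm_smul, Real.norm_of_nonneg hε.le] at h1
    rw [dist_eq_norm, dist_eq_norm]
    refine le_trans ?_ h1
    rw [mul_assoc]
    gcongr
    exact hφe y z
  have hpos : 0 < h / (2 * σ) * ε := by positivity
  have h3 := ofReal_pow_mul_hausdorffMeasure_le n hpos hψe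
  have h4 : (μH[(n : ℝ)] : Measure (Fin n → ℝ)) = volume := by
    have := hausdorffMeasure_pi_real (ι := Fin n)
    rwa [Fintype.card_fin] at this
  have h5 : volume B = ENNReal.ofReal (((n : ℝ) + 1)⁻¹ ^ n) := by
    rw [hB, Real.volume_Icc_pi]
    simp only [Pi.zero_apply, sub_zero, Finset.prod_const, Finset.card_univ, Fintype.card_fin]
    rw [ENNReal.ofReal_pow (by positivity)]
  rw [h4, h5, ← ENNReal.ofReal_pow hpos.le, ← ENNReal.ofReal_mul (by positivity), ← mul_pow] at h3
  have hfin : μHE[n] (ψ '' B) ≠ ⊤ := ((measure_mono hψf).trans_lt (facet_image_lt_top K hf)).ne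
  -- The factor `a` converts the Hausdorff measure `μH`, normalized by the sup norm cube, into the
  -- Euclidean normalization `μHE`.
  set a := Measure.addHaarScalarFactor (volume : Measure (EuclideanSpace ℝ (Fin n))) μH[n] with ha
  have h6 : (a : ℝ) * (h / (2 * σ) * ε * ((n : ℝ) + 1)⁻¹) ^ n ≤ (μHE[n]).real (ψ '' B) := by
    rw [Measure.real, ← ENNReal.ofReal_le_iff_le_toReal hfin, ENNReal.ofReal_mul a.coe_nonneg,
      ENNReal.ofReal_coe_nnreal, Measure.euclideanHausdorffMeasure_def, Measure.smul_apply,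
      ENNReal.smul_def, smul_eq_mul, ← ha]
    gcongr
  have : IsFiniteMeasure ((μHE[n] : Measure (Pt (n + 1))).restrict (T.map K '' f)) :=
    ⟨by rw [Measure.restrict_apply_univ]; exact facet_image_lt_top K hf⟩
  have hint : IntegrableOn (fun p => T.fe c p ^ 2) (T.map K '' f) μHE[n] := by
    simpa only [sq, IntegrableOn] using hT.integrable_fe_mul hT c c (μHE[n].restrict (T.map K '' f))
  have hsq : c (T.vert K v) ^ 2 ≤ c (T.vert K w) ^ 2 := sq_le_sq.2 (hmax v hv)
  calc (a : ℝ) * (ε / (2 * σ * (n + 1))) ^ n / 4 * h ^ n * c (T.vert K v) ^ 2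
      = (a : ℝ) * (h / (2 * σ) * ε * ((n : ℝ) + 1)⁻¹) ^ n * (c (T.vert K v) ^ 2 / 4) := by
        have : h / (2 * σ) * ε * ((n : ℝ) + 1)⁻¹ = ε / (2 * σ * (n + 1)) * h := by field_simp
        rw [this, mul_pow]
        ring
    _ ≤ (μHE[n]).real (ψ '' B) * (c (T.vert K w) ^ 2 / 4) := by gcongr
    _ = ∫ _p in ψ '' B, c (T.vert K w) ^ 2 / 4 ∂μHE[n] := by
        rw [setIntegral_const, smul_eq_mul]
    _ ≤ ∫ p in ψ '' B, T.fe c p ^ 2 ∂μHE[n] := by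
        refine setIntegral_mono_on (integrableOn_const hfin) (hint.mono_set hψf)
          hψc.isClosed.measurableSet ?_
        rintro _ ⟨z, hz, rfl⟩
        have h7 := hT.half_le_abs_fe hL hb hε hε' c K hf hw hmax (hχf z hz) (hχn z hz)
        calc c (T.vert K w) ^ 2 / 4 = (|c (T.vert K w)| / 2) ^ 2 := by
              rw [div_pow, sq_abs]; norm_num
          _ ≤ |T.fe c (T.map K (χ z))| ^ 2 := by gcongr
          _ = T.fe c (ψ z) ^ 2 := sq_abs _
    _ ≤ ∫ p in T.map K '' f, T.fe c p ^ 2 ∂μHE[n] :=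
        setIntegral_mono_set hint (Filter.Eventually.of_forall fun p => sq_nonneg _)
          (Filter.Eventually.of_forall hψf)

end Conforming

end Mesh

/-! ### Nodal values and the `L²` norm on the interface. -/

namespace Coupled

variable {n : ℕ} {P : Coupled (n + 1)}

theorem γ_isClosed : IsClosed P.γ := isClosed_frontier.inter isClosed_frontier

theorem integral_surface (g : Pt (n + 1) → ℝ) :
    ∫ p : P.γ, g p ∂P.surface = ∫ p in P.γ, g p ∂μHE[n] :=
  integral_subtype_comap γ_isClosed.measurableSet g

namespace Admissible

theorem measure_γ_lt_top (hP : P.Admissible) : μHE[n] P.γ < ⊤ := by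
  have hsub : P.γ ⊆ ⋃ K, ⋃ f ∈ ((P.mesh 0).kind K).facets (n + 1), (P.mesh 0).map K '' f := by
    intro p hp
    obtain ⟨K, f, hf, hpf, -⟩ := hP.interface 0 p hp
    simp only [Set.mem_iUnion]
    exact ⟨K, f, hf, hpf⟩
  refine (measure_mono hsub).trans_lt ?_
  refine (measure_iUnion_fintype_le _ _).trans_lt (ENNReal.sum_lt_top.2 fun K _ => ?_)
  exact measure_biUnion_lt_top (RefCell.facet_finite _) fun f hf => Mesh.facet_image_lt_top K hf

theorem isFiniteMeasure_γ (hP : P.Admissible) :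
    IsFiniteMeasure ((μHE[n] : Measure (Pt (n + 1))).restrict P.γ) :=
  ⟨by rw [Measure.restrict_apply_univ]; exact hP.measure_γ_lt_top⟩

/-- Every node on the interface is a vertex of a facet contained in the interface. -/
theorem exists_facet (hP : P.Admissible) (i : Fin 2) {r : Fin (P.mesh i).nNode} (hr :
    (P.mesh i).node r ∈ P.γ) :
    ∃ K v f, f ∈ ((P.mesh i).kind K).facets (n + 1) ∧ (P.mesh i).vert K v = r ∧
      ((P.mesh i).kind K).vertexPt (n + 1) v ∈ f ∧ (P.mesh i).map K '' f ⊆ P.γ := by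
  obtain ⟨K, f, hf, ⟨x, hx, hxr⟩, hsub⟩ := hP.interface i _ hr
  have hT := hP.conforming i
  have h1 := hT.fe_node (Pi.single r 1) r
  -- The basis function of `r` equals 1 at its node, so on `K` some vertex carrying `r` has a
  -- nonzero shape function at `x ∈ f`; such a vertex belongs to `f`.
  rw [← hxr, hT.fe_map _ K (RefCell.facet_subset _ hf hx), Pi.single_eq_same] at h1
  obtain ⟨v, -, hv⟩ := Finset.exists_ne_zero_of_sum_ne_zero (h1.trans_ne one_ne_zero)
  refine ⟨K, v, f, hf, ?_, ?_, hsub⟩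
  · by_contra hne
    exact hv (by rw [Pi.single_eq_of_ne hne, zero_mul])
  · exact RefCell.vertexPt_mem_facet _ hf hx (right_ne_zero_of_mul hv)

end Admissible

open Classical in
/-- The `L²` norm on the interface controls the nodal values at the interface. -/
theorem exists_sum_sq_le_surface (n : ℕ) {σ : ℝ} (hσ : 0 < σ) : ∃ κ : ℝ, 0 < κ ∧
    ∀ (P : Coupled (n + 1)), P.Admissible → ∀ (i : Fin 2) (h : ℝ), 0 < h →
      (P.mesh i).QuasiUniform h σ → ∀ c : Fin (P.mesh i).nNode → ℝ,
      (∀ r, (P.mesh i).node r ∉ P.γ → c r = 0) →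
      κ * h ^ n * ∑ r, c r ^ 2 ≤ ∫ p in P.γ, (P.mesh i).fe c p ^ 2 ∂μHE[n] := by
  obtain ⟨m, L, hm, hL, hb⟩ := RefCell.exists_shape_bounds (n + 1)
  obtain ⟨ε, hε, hε1, hε2, hε3, hε4⟩ : ∃ ε : ℝ, 0 < ε ∧ ε ≤ 1 ∧ 2 * m * L * ε ≤ 1 ∧
      2 * m * L * σ ^ 2 * ε ≤ 1 ∧ ε ≤ (2 * (n + 1 : ℕ) : ℝ)⁻¹ := by
    refine ⟨min (min 1 (2 * m * L)⁻¹) (min (2 * m * L * σ ^ 2)⁻¹ (2 * (n + 1 : ℕ) : ℝ)⁻¹),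
      by positivity, (min_le_left _ _).trans (min_le_left _ _), ?_, ?_,
      (min_le_right _ _).trans (min_le_right _ _)⟩
    · rw [← le_inv_mul_iff₀ (by positivity), mul_one]
      exact (min_le_left _ _).trans (min_le_right _ _)
    · rw [← le_inv_mul_iff₀ (by positivity), mul_one]
      exact (min_le_right _ _).trans (min_le_left _ _)
  set a := Measure.addHaarScalarFactor (volume : Measure (EuclideanSpace ℝ (Fin n))) μH[n]
  have ha : 0 < (a : ℝ) := NNReal.coe_pos.2 (pos_iff_ne_zero.2
    (Measure.addHaarScalarFactor_volume_hausdorffMeasure_ne_zero n))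
  set A := (a : ℝ) * (ε / (2 * σ * (n + 1))) ^ n / 4 with hA
  have hA0 : 0 < A := by positivity
  -- Overlap bound for the chosen facets: the number of cells through a point times the number of
  -- vertices per cell.
  set N := (2 * σ ^ 2 / ε) ^ (n + 1) * m with hN
  have hN0 : 0 < N := by positivity
  refine ⟨A / N, by positivity, ?_⟩
  intro P hP i h hh hq c hc
  have := hP.isFiniteMeasure_γ
  have hT := hP.conforming i
  have hint : IntegrableOn (fun p => (P.mesh i).fe c p ^ 2) P.γ μHE[n] := by
    simpa only [sq, IntegrableOn] using hT.integrable_fe_mul hT c c (μHE[n].restrict P.γ)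
  have key : ∀ r : {r // (P.mesh i).node r ∈ P.γ}, ∃ K v f,
      f ∈ ((P.mesh i).kind K).facets (n + 1) ∧ (P.mesh i).vert K v = r.1 ∧
      ((P.mesh i).kind K).vertexPt (n + 1) v ∈ f ∧ (P.mesh i).map K '' f ⊆ P.γ :=
    fun r => hP.exists_facet i r.2
  choose K v f hf hKv hvf hsub using key
  have hmeas : ∀ r, MeasurableSet ((P.mesh i).map (K r) '' f r) := fun r =>
    (Mesh.facet_image_isCompact (K r) (hf r)).isClosed.measurableSet
  have hcount : ∀ p, ((Finset.univ.filter fun r => p ∈ (P.mesh i).map (K r) '' f r).card : ℝ)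
      ≤ N := by
    intro p
    have h1 : (Finset.univ.filter fun r => p ∈ (P.mesh i).map (K r) '' f r).card ≤
        ((Finset.univ.filter fun K' => p ∈ (P.mesh i).cell K').sigma fun K' =>
          (Finset.univ : Finset (((P.mesh i).kind K').Vertex (n + 1)))).card := by
      -- Several nodes may choose the same facet; recording the vertex along with the cell recovers
      -- the node.
      refine Finset.card_le_card_of_injOn (fun r => ⟨K r, v r⟩) ?_ ?_
      · intro r hr
        have hr' := (Finset.mem_filter.1 hr).2
        refine Finset.mem_coe.2 (Finset.mem_sigma.2 ⟨?_, Finset.mem_univ _⟩)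
        exact Finset.mem_filter.2 ⟨Finset.mem_univ _,
          Set.image_mono (RefCell.facet_subset _ (hf r)) hr'⟩
      · intro r _ s _ hrs
        apply Subtype.ext
        rw [← hKv r, ← hKv s]
        exact congrArg (fun q : (K' : Fin (P.mesh i).nCell) ×
          ((P.mesh i).kind K').Vertex (n + 1) => (P.mesh i).vert q.1 q.2) hrs
    rw [Finset.card_sigma] at h1
    calc ((Finset.univ.filter fun r => p ∈ (P.mesh i).map (K r) '' f r).card : ℝ)
        ≤ ∑ K' ∈ Finset.univ.filter fun K' => p ∈ (P.mesh i).cell K',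
            (Fintype.card (((P.mesh i).kind K').Vertex (n + 1)) : ℝ) := by exact_mod_cast h1
      _ ≤ ∑ K' ∈ Finset.univ.filter fun K' => p ∈ (P.mesh i).cell K', m :=
          Finset.sum_le_sum fun K' _ => (hb _).1
      _ = (Finset.univ.filter fun K' => p ∈ (P.mesh i).cell K').card * m := by simp
      _ ≤ N := by
          rw [hN]
          gcongr
          exact hq.card_cells_le n.succ_pos hm hL hb hh hσ hT hε hε3 hε4 p
  have hsum : ∑ r, c r ^ 2 = ∑ r : {r // (P.mesh i).node r ∈ P.γ}, c r ^ 2 := by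
    refine (Fintype.sum_of_injective Subtype.val Subtype.val_injective _ _ ?_ fun _ => rfl).symm
    intro r hr
    rw [hc r (fun h0 => hr ⟨⟨r, h0⟩, rfl⟩)]
    norm_num
  have hmain : A * h ^ n * ∑ r, c r ^ 2 ≤
      N * ∫ p in P.γ, (P.mesh i).fe c p ^ 2 ∂μHE[n] := by
    have hI : ∀ r, IntegrableOn (((P.mesh i).map (K r) '' f r).indicator
        fun p => (P.mesh i).fe c p ^ 2) P.γ μHE[n] := fun r => hint.indicator (hmeas r)
    calc A * h ^ n * ∑ r, c r ^ 2
        = ∑ r : {r // (P.mesh i).node r ∈ P.γ}, A * h ^ n * c r ^ 2 := by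
          rw [hsum, Finset.mul_sum]
      _ ≤ ∑ r, ∫ p in P.γ, ((P.mesh i).map (K r) '' f r).indicator
            (fun p => (P.mesh i).fe c p ^ 2) p ∂μHE[n] := by
          refine Finset.sum_le_sum fun r _ => ?_
          rw [setIntegral_indicator (hmeas r), Set.inter_eq_right.2 (hsub r), ← hKv r]
          exact hT.le_setIntegral_facet hL hb hh hσ hq hε hε1 hε2 hε3 c (K r) (hf r) (hvf r)
      _ = ∫ p in P.γ, ∑ r, ((P.mesh i).map (K r) '' f r).indicator
            (fun p => (P.mesh i).fe c p ^ 2) p ∂μHE[n] :=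
          (integral_finsetSum _ fun r _ => hI r).symm
      _ ≤ ∫ p in P.γ, N * (P.mesh i).fe c p ^ 2 ∂μHE[n] := by
          refine integral_mono (integrable_finsetSum _ fun r _ => hI r) (hint.const_mul N)
            fun p => ?_
          simp only [Set.indicator_apply]
          rw [← Finset.sum_filter, Finset.sum_const, nsmul_eq_mul]
          gcongr
          exact hcount p
      _ = _ := integral_const_mul _ _
  rw [div_mul_eq_mul_div, div_mul_eq_mul_div, div_le_iff₀ hN0]
  linarith

end Coupled

/-! ### Nodal coefficients and Gram matrices. -/

namespace Mesh

variable {ν : ℕ} {T : Mesh ν}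

/-- The finite element function as a linear function of its nodal coefficients. -/
noncomputable def feLin (T : Mesh ν) : (Fin T.nNode → ℝ) →ₗ[ℝ] (Pt ν → ℝ) where
  toFun := T.fe
  map_add' c d := by
    funext p
    simp [fe, add_mul, Finset.sum_add_distrib]
  map_smul' a c := by
    funext p
    simp [fe, mul_assoc, Finset.mul_sum]

theorem fe_single (r : Fin T.nNode) : T.fe (Pi.single r 1) = T.basis r := by
  funext p
  rw [fe, Fintype.sum_eq_single r]
  · simp
  · intro s hs
    simp [hs]

theorem fe_extend {ι : Type} [Fintype ι] {e : ι → Fin T.nNode} (he : Function.Injective e)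
    (y : ι → ℝ) (p : Pt ν) :
    T.fe (Function.extend e y 0) p = ∑ j, y j * T.basis (e j) p := by
  refine (Fintype.sum_of_injective e he _ _ ?_ ?_).symm
  · intro r hr
    rw [Function.extend_apply' _ _ _ (by simpa using hr)]
    simp
  · intro j
    rw [he.extend_apply]

theorem column_eq_fe {ι : Type} [Fintype ι] {d : ℕ} {e : ι → Fin T.nNode}
    (he : Function.Injective e) (Φ : Matrix ι (Fin d) ℝ) (j : Fin d) :
    T.column e Φ j = T.fe (Function.extend e (fun r => Φ r j) 0) := by
  funext p
  rw [fe_extend he]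
  rfl

/-- The quadratic form of a Gram matrix of nodal basis functions. -/
theorem Conforming.dotProduct_gram_mulVec (hT : T.Conforming) {ι : Type} [Fintype ι]
    {e : ι → Fin T.nNode} (he : Function.Injective e) (μ : Measure (Pt ν)) [IsFiniteMeasure μ]
    (y : ι → ℝ) :
    y ⬝ᵥ (Matrix.of fun r s => ∫ p, T.basis (e r) p * T.basis (e s) p ∂μ) *ᵥ y =
      ∫ p, T.fe (Function.extend e y 0) p ^ 2 ∂μ := by
  have hint : ∀ r s, Integrable (fun p => T.basis r p * T.basis s p) μ := by
    intro r s
    simpa only [fe_single] using hT.integrable_fe_mul hT (Pi.single r 1) (Pi.single s 1) μ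
  have h1 : ∀ p, T.fe (Function.extend e y 0) p ^ 2 =
      ∑ r, ∑ s, y r * y s * (T.basis (e r) p * T.basis (e s) p) := by
    intro p
    rw [fe_extend he, sq, Finset.sum_mul_sum]
    refine Finset.sum_congr rfl fun r _ => Finset.sum_congr rfl fun s _ => ?_
    ring
  simp only [h1]
  rw [integral_finsetSum _ fun r _ => integrable_finsetSum _ fun s _ => (hint _ _).const_mul _]
  simp only [dotProduct, Matrix.mulVec, Matrix.of_apply, Finset.mul_sum]
  refine Finset.sum_congr rfl fun r _ => ?_
  rw [integral_finsetSum _ fun s _ => (hint _ _).const_mul _]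
  refine Finset.sum_congr rfl fun s _ => ?_
  rw [integral_const_mul]
  ring

theorem Conforming.gram_posDef (hT : T.Conforming) {ι : Type} [Fintype ι]
    {e : ι → Fin T.nNode} (he : Function.Injective e) (μ : Measure (Pt ν)) [IsFiniteMeasure μ]
    (h0 : ∀ y : ι → ℝ, ∫ p, T.fe (Function.extend e y 0) p ^ 2 ∂μ = 0 → y = 0) :
    (Matrix.of fun r s => ∫ p, T.basis (e r) p * T.basis (e s) p ∂μ).PosDef := by
  refine Matrix.PosDef.of_dotProduct_mulVec_pos ?_ ?_
  · ext r s
    simp [mul_comm]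
  · intro y hy
    rw [star_trivial, hT.dotProduct_gram_mulVec he]
    exact (integral_nonneg fun _ => sq_nonneg _).lt_of_ne fun h => hy (h0 y h.symm)

end Mesh

/-! ### Reduced spaces and projected mass matrices. -/

namespace Coupled

theorem ifaceIdx_injective {ν : ℕ} (P : Coupled ν) (i : Fin 2) :
    Function.Injective (P.ifaceIdx i) := Subtype.val_injective

theorem innerIdx_injective {ν : ℕ} (P : Coupled ν) (i : Fin 2) :
    Function.Injective (P.innerIdx i) := Subtype.val_injective

theorem γ_disjoint {ν : ℕ} (P : Coupled ν) (i : Fin 2) : Disjoint P.γ (P.Ω i) := by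
  have h1 : P.γ ⊆ frontier (P.Ω i) := by
    fin_cases i
    · exact Set.inter_subset_left
    · exact Set.inter_subset_right
  refine Set.disjoint_left.2 fun p hp hp' => ?_
  have h2 := h1 hp
  rw [Ω, (Mesh.region_isOpen (T := P.mesh i)).frontier_eq] at h2
  exact h2.2 hp'

/-- The inclusion of the interface and interior nodes into all nodes. -/
def nodeIdx {ν : ℕ} (P : Coupled ν) (i : Fin 2) :
    P.IfaceNode i ⊕ P.InnerNode i → Fin (P.mesh i).nNode :=
  Sum.elim (P.ifaceIdx i) (P.innerIdx i)

theorem nodeIdx_injective {ν : ℕ} (P : Coupled ν) (i : Fin 2) :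
    Function.Injective (P.nodeIdx i) := by
  refine (P.ifaceIdx_injective i).sumElim (P.innerIdx_injective i) ?_
  intro r s hrs
  have h1 := r.2.1
  have h2 := s.2
  change r.1 = s.1 at hrs
  rw [hrs] at h1
  exact Set.disjoint_left.1 (P.γ_disjoint i) h1 h2

namespace ReducedBasis

section Spaces

variable {ν : ℕ} {P : Coupled ν} (R : P.ReducedBasis)

theorem exists_fe_of_mem_Sγ {i : Fin 2} {v : Pt ν → ℝ} (hv : v ∈ R.Sγ i) :
    ∃ c, (∀ r, (P.mesh i).node r ∉ P.γ → c r = 0) ∧ v = (P.mesh i).fe c := by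
  -- Vanishing off the interface is a linear condition on coefficients, so checking it on the
  -- spanning columns is enough.
  let S : Submodule ℝ (Fin (P.mesh i).nNode → ℝ) :=
    ⨅ r, ⨅ _ : (P.mesh i).node r ∉ P.γ, LinearMap.ker (LinearMap.proj r)
  have hle : R.Sγ i ≤ S.map (P.mesh i).feLin := by
    refine Submodule.span_le.2 ?_
    rintro _ ⟨j, rfl⟩
    refine ⟨Function.extend (P.ifaceIdx i) (fun r => R.Φγ i r j) 0, ?_,
      (Mesh.column_eq_fe (P.ifaceIdx_injective i) _ _).symm⟩
    simp only [S, SetLike.mem_coe, Submodule.mem_iInf, LinearMap.mem_ker, LinearMap.proj_apply]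
    intro r hr
    rw [Function.extend_apply']
    · rfl
    · rintro ⟨s, rfl⟩
      exact hr s.2.1
  obtain ⟨c, hc, rfl⟩ := hle hv
  refine ⟨c, fun r hr => ?_, rfl⟩
  simp only [S, SetLike.mem_coe, Submodule.mem_iInf, LinearMap.mem_ker, LinearMap.proj_apply] at hc
  exact hc r hr

theorem exists_fe_of_mem_sup {i : Fin 2} {v : Pt ν → ℝ} (hv : v ∈ R.Sγ i ⊔ R.S0 i) :
    ∃ c, v = (P.mesh i).fe c := by
  have hle : R.Sγ i ⊔ R.S0 i ≤ LinearMap.range (P.mesh i).feLin := by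
    refine sup_le (Submodule.span_le.2 ?_) (Submodule.span_le.2 ?_)
    · rintro _ ⟨j, rfl⟩
      exact ⟨_, (Mesh.column_eq_fe (P.ifaceIdx_injective i) _ _).symm⟩
    · rintro _ ⟨j, rfl⟩
      exact ⟨_, (Mesh.column_eq_fe (P.innerIdx_injective i) _ _).symm⟩
  obtain ⟨c, rfl⟩ := hle hv
  exact ⟨c, rfl⟩

theorem normV_sq_nonneg (v : (Pt ν → ℝ) × (Pt ν → ℝ)) :
    0 ≤ (∫ p in P.Ω 0, v.1 p ^ 2) + ∫ p in P.Ω 1, v.2 p ^ 2 :=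
  add_nonneg (integral_nonneg fun _ => sq_nonneg _) (integral_nonneg fun _ => sq_nonneg _)

theorem normV_sq_le_a (v : (Pt ν → ℝ) × (Pt ν → ℝ)) : P.normV v ^ 2 ≤ P.a v v := by
  rw [normV, Real.sq_sqrt (normV_sq_nonneg v), a]
  simp only [sq, le_refl]

variable {h : Fin 2 → ℝ} {σ : ℝ}

theorem eq_zero_of_normV (hν : 0 < ν) (hσ : 0 < σ) (hP : P.Admissible) (hh : ∀ i, 0 < h i)
    (hq : ∀ i, (P.mesh i).QuasiUniform (h i) σ) {v : (Pt ν → ℝ) × (Pt ν → ℝ)} (hv : v ∈ R.V)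
    (h0 : P.normV v = 0) : v = 0 := by
  rw [normV, Real.sqrt_eq_zero (normV_sq_nonneg v), add_eq_zero_iff_of_nonneg
    (integral_nonneg fun _ => sq_nonneg _) (integral_nonneg fun _ => sq_nonneg _)] at h0
  have key : ∀ (i : Fin 2) (w : Pt ν → ℝ), w ∈ R.Sγ i ⊔ R.S0 i → ∫ p in P.Ω i, w p ^ 2 = 0 →
      w = 0 := by
    intro i w hw h1
    obtain ⟨c, rfl⟩ := R.exists_fe_of_mem_sup hw
    rw [(hP.conforming i).eq_zero_of_setIntegral_fe_sq hν (hh i) hσ (hq i) c h1]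
    exact (P.mesh i).feLin.map_zero
  exact Prod.ext (key 0 _ hv.1 h0.1) (key 1 _ hv.2 h0.2)

/-- Presents the projected mass matrix as a congruence of a single Gram matrix by an injective block
diagonal matrix, so that definiteness carries over. -/
theorem M_eq (i : Fin 2) : R.M i = (Matrix.fromBlocks (R.Φγ i) 0 0 (R.Φ0 i))ᵀ *
    P.mass i (P.nodeIdx i) (P.nodeIdx i) * Matrix.fromBlocks (R.Φγ i) 0 0 (R.Φ0 i) := by
  have h1 : P.mass i (P.nodeIdx i) (P.nodeIdx i) = Matrix.fromBlocks
      (P.mass i (P.ifaceIdx i) (P.ifaceIdx i)) (P.mass i (P.ifaceIdx i) (P.innerIdx i))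
      (P.mass i (P.innerIdx i) (P.ifaceIdx i)) (P.mass i (P.innerIdx i) (P.innerIdx i)) := by
    ext r s
    rcases r with r | r <;> rcases s with s | s <;> rfl
  rw [h1, Matrix.fromBlocks_transpose, Matrix.fromBlocks_multiply, Matrix.fromBlocks_multiply, M]
  simp

theorem M_posDef (hν : 0 < ν) (hσ : 0 < σ) (hP : P.Admissible) (hh : ∀ i, 0 < h i)
    (hq : ∀ i, (P.mesh i).QuasiUniform (h i) σ) (i : Fin 2) : (R.M i).PosDef := by
  have hT := hP.conforming i
  have h1 : (P.mass i (P.nodeIdx i) (P.nodeIdx i)).PosDef := by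
    refine hT.gram_posDef (P.nodeIdx_injective i) (volume.restrict (P.mesh i).region) ?_
    intro y hy
    have := hT.eq_zero_of_setIntegral_fe_sq hν (hh i) hσ (hq i) _ hy
    funext j
    rw [← (P.nodeIdx_injective i).extend_apply y 0 j, this]
    rfl
  rw [M_eq, ← Matrix.conjTranspose_eq_transpose_of_trivial]
  refine h1.conjTranspose_mul_mul_same ?_
  intro x y hxy
  rw [← Sum.elim_comp_inl_inr x, ← Sum.elim_comp_inl_inr y] at hxy ⊢
  simp only [Matrix.fromBlocks_mulVec, Sum.elim_comp_inl, Sum.elim_comp_inr, Matrix.zero_mulVec,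
    add_zero, zero_add, Sum.elim_eq_iff] at hxy
  rw [Matrix.mulVec_injective_iff.2 (R.linearIndependent_γ i) hxy.1,
    Matrix.mulVec_injective_iff.2 (R.linearIndependent_0 i) hxy.2]

end Spaces

/-! ### The lifting operator and the inf-sup condition. -/

section Lifting

variable {ν : ℕ} {P : Coupled ν} (R : P.ReducedBasis)

/-- The signed inclusion of functions on the subdomain `Ω_k` into pairs of functions. -/
def signedIncl (ν : ℕ) : Fin 2 → (Pt ν → ℝ) →ₗ[ℝ] (Pt ν → ℝ) × (Pt ν → ℝ)
  | 0 => LinearMap.inl ℝ _ _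
  | 1 => -LinearMap.inr ℝ _ _

theorem signedIncl_mem {k : Fin 2} {v : Pt ν → ℝ} (hv : v ∈ R.Sγ k) :
    signedIncl ν k v ∈ R.V := by
  fin_cases k
  · exact ⟨Submodule.mem_sup_left hv, zero_mem _⟩
  · refine ⟨?_, ?_⟩
    · change -(0 : Pt ν → ℝ) ∈ _
      rw [neg_zero]
      exact zero_mem _
    · exact neg_mem (Submodule.mem_sup_left hv)

theorem b_signedIncl (k : Fin 2) (v : Pt ν → ℝ) (μ : P.γ → ℝ) :
    P.b (signedIncl ν k v) μ = ∫ p, P.trace v p * μ p ∂P.surface := by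
  fin_cases k <;> simp [signedIncl, b, trace]

theorem normV_signedIncl (k : Fin 2) (v : Pt ν → ℝ) :
    P.normV (signedIncl ν k v) = Real.sqrt (∫ p in P.Ω k, v p ^ 2) := by
  fin_cases k <;> simp [signedIncl, normV]

theorem b_neg (v : (Pt ν → ℝ) × (Pt ν → ℝ)) (μ : P.γ → ℝ) : P.b (-v) μ = -P.b v μ := by
  rw [b, b, ← integral_neg]
  congr 1
  funext p
  simp only [trace, LinearMap.coe_mk, AddHom.coe_mk, Prod.fst_neg, Prod.snd_neg, Pi.neg_apply]
  ring

theorem normW_sq (μ : P.γ → ℝ) : P.normW μ ^ 2 = ∫ p, μ p ^ 2 ∂P.surface :=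
  Real.sq_sqrt (integral_nonneg fun _ => sq_nonneg _)

/-- A uniform trace bound for interface modes yields the lifting operator. -/
theorem exists_lifting {k : Fin 2} {C : ℝ}
    (hC : ∀ v ∈ R.Sγ k, Real.sqrt (∫ p in P.Ω k, v p ^ 2) ≤ C * P.normW (P.trace v)) :
    ∃ Q : R.W k →ₗ[ℝ] R.V, ∀ μ : R.W k,
      P.b (Q μ).1 μ.1 = P.normW μ.1 ^ 2 ∧ P.normV (Q μ).1 ≤ C * P.normW μ.1 := by
  have hsurj : Function.Surjective (P.trace.submoduleMap (R.Sγ k)) :=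
    P.trace.submoduleMap_surjective _
  -- Vector spaces are projective, so the trace on the interface modes has a linear right inverse
  -- `g`, which selects a mode for each multiplier.
  have hproj : Module.Projective ℝ ((R.Sγ k).map P.trace) :=
    have := Module.Free.of_divisionRing ℝ ((R.Sγ k).map P.trace)
    Module.Projective.of_free
  obtain ⟨g, hg⟩ := LinearMap.exists_rightInverse_of_surjective _
    (LinearMap.range_eq_top.2 hsurj)
  refine ⟨((signedIncl ν k).domRestrict (R.Sγ k)).codRestrict R.V
    (fun v => R.signedIncl_mem v.2) ∘ₗ g, fun μ => ?_⟩
  have h1 : P.trace (g μ).1 = μ.1 :=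
    congrArg Subtype.val (LinearMap.congr_fun hg μ)
  change P.b (signedIncl ν k (g μ).1) μ.1 = _ ∧ P.normV (signedIncl ν k (g μ).1) ≤ _
  constructor
  · rw [b_signedIncl, h1, normW_sq]
    simp only [sq]
  · rw [normV_signedIncl, ← h1]
    exact hC _ (g μ).2

/-- Needed when the multiplier has norm zero: a supremum over the empty set would be `⊥` in `EReal`.
-/
theorem exists_ne_zero_mem_V (hP : P.Admissible) {k : Fin 2} (hk : 0 < R.dγ k) :
    ∃ v ∈ R.V, v ≠ 0 := by
  have hmem : (P.mesh k).column (P.ifaceIdx k) (R.Φγ k) ⟨0, hk⟩ ∈ R.Sγ k :=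
    Submodule.subset_span ⟨_, rfl⟩
  refine ⟨_, R.signedIncl_mem hmem, fun h0 => ?_⟩
  have h1 : (P.mesh k).column (P.ifaceIdx k) (R.Φγ k) ⟨0, hk⟩ = 0 := by
    generalize (P.mesh k).column (P.ifaceIdx k) (R.Φγ k) ⟨0, hk⟩ = v at h0
    clear hmem hk
    fin_cases k
    · exact congrArg Prod.fst h0
    · exact neg_eq_zero.1 (congrArg Prod.snd h0)
  refine (R.linearIndependent_γ k).ne_zero ⟨0, hk⟩ (funext fun r => ?_)
  rw [Mesh.column_eq_fe (P.ifaceIdx_injective k)] at h1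
  have h2 := (hP.conforming k).fe_node
    (Function.extend (P.ifaceIdx k) (fun r => R.Φγ k r ⟨0, hk⟩) 0) (P.ifaceIdx k r)
  rw [h1, (P.ifaceIdx_injective k).extend_apply] at h2
  exact h2.symm

theorem infSup_of_lifting {k : Fin 2} {C : ℝ} (hC : 0 < C)
    (hdef : ∀ v ∈ R.V, P.normV v = 0 → v = 0) (hne : ∃ v ∈ R.V, v ≠ 0)
    (hlift : ∀ μ ∈ R.W k, ∃ v ∈ R.V, P.b v μ = P.normW μ ^ 2 ∧ P.normV v ≤ C * P.normW μ) :
    R.InfSup k C⁻¹ := by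
  intro μ hμ
  have hW : 0 ≤ P.normW μ := Real.sqrt_nonneg _
  suffices h : ∃ v ∈ R.V, v ≠ 0 ∧ C⁻¹ * P.normW μ ≤ P.b v μ / P.normV v by
    obtain ⟨v, hv, hv0, hle⟩ := h
    exact (EReal.coe_le_coe_iff.2 hle).trans
      (le_iSup₂ (f := fun v (_ : v ∈ {v | v ∈ R.V ∧ v ≠ 0}) =>
        ((P.b v μ / P.normV v : ℝ) : EReal)) v ⟨hv, hv0⟩)
  -- For a multiplier of norm zero any nonzero `v` works up to sign. Otherwise the lift is nonzero
  -- and serves as the test function.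
  rcases hW.eq_or_lt with h0 | h0
  · obtain ⟨v, hv, hv0⟩ := hne
    rcases le_total 0 (P.b v μ) with hb | hb
    · refine ⟨v, hv, hv0, ?_⟩
      rw [← h0, mul_zero]
      exact div_nonneg hb (Real.sqrt_nonneg _)
    · refine ⟨-v, neg_mem hv, neg_ne_zero.2 hv0, ?_⟩
      rw [← h0, mul_zero, b_neg]
      exact div_nonneg (neg_nonneg.2 hb) (Real.sqrt_nonneg _)
  · obtain ⟨v, hv, hb, hn⟩ := hlift μ hμ
    have hv0 : v ≠ 0 := by
      rintro rfl
      have : P.b 0 μ = 0 := by simp [b, trace]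
      rw [this] at hb
      have : 0 < P.normW μ ^ 2 := by positivity
      linarith
    have hn0 : 0 < P.normV v :=
      (Real.sqrt_nonneg _).lt_of_ne fun h1 => hv0 (hdef v hv h1.symm)
    refine ⟨v, hv, hv0, ?_⟩
    rw [hb, le_div_iff₀ hn0, mul_assoc, inv_mul_le_iff₀ hC]
    calc P.normW μ * P.normV v ≤ P.normW μ * (C * P.normW μ) := by gcongr
      _ = C * P.normW μ ^ 2 := by ring

end Lifting

/-! ### Constraint matrix and Schur complement. -/

section Constraint

variable {n : ℕ} {P : Coupled (n + 1)} (R : P.ReducedBasis)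

theorem constraint_self_posDef (hP : P.Admissible) {k : Fin 2} {κ : ℝ} (hκ : 0 < κ)
    (hle : ∀ c : Fin (P.mesh k).nNode → ℝ, (∀ r, (P.mesh k).node r ∉ P.γ → c r = 0) →
      κ * ∑ r, c r ^ 2 ≤ ∫ p in P.γ, (P.mesh k).fe c p ^ 2 ∂μHE[n]) :
    (P.constraint k k).PosDef := by
  have := hP.isFiniteMeasure_γ
  have h1 : P.constraint k k = Matrix.of fun r s => ∫ p, (P.mesh k).basis (P.ifaceIdx k r) p *
      (P.mesh k).basis (P.ifaceIdx k s) p ∂(μHE[n].restrict P.γ) := by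
    ext r s
    exact integral_surface fun p => (P.mesh k).basis r.1 p * (P.mesh k).basis s.1 p
  rw [h1]
  refine (hP.conforming k).gram_posDef (P.ifaceIdx_injective k) _ fun y hy => ?_
  set c := Function.extend (P.ifaceIdx k) y 0 with hc
  have h2 := hle c (fun r hr => by
    rw [hc, Function.extend_apply']
    · rfl
    · rintro ⟨s, rfl⟩
      exact hr s.2.1)
  rw [hy] at h2
  have h3 : ∑ r, c r ^ 2 = 0 :=
    le_antisymm (nonpos_of_mul_nonpos_right h2 hκ) (Finset.sum_nonneg fun r _ => sq_nonneg _)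
  rw [Finset.sum_eq_zero_iff_of_nonneg fun r _ => sq_nonneg _] at h3
  funext j
  rw [← (P.ifaceIdx_injective k).extend_apply y 0 j]
  exact pow_eq_zero_iff two_ne_zero |>.1 (h3 _ (Finset.mem_univ _))

/-- On side `k` the same modes appear on both sides of the interface block, making it a definite
congruence and hence invertible. -/
theorem G_self_vecMul_injective {k : Fin 2} (hpos : (P.constraint k k).PosDef) :
    Function.Injective (R.G k k).vecMul := by
  have h1 : ((R.Φγ k)ᵀ * P.constraint k k * R.Φγ k).PosDef := by
    rw [← Matrix.conjTranspose_eq_transpose_of_trivial]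
    exact hpos.conjTranspose_mul_mul_same (Matrix.mulVec_injective_iff.2 (R.linearIndependent_γ k))
  intro x y hxy
  simp only [G, Matrix.vecMul_fromCols, Sum.elim_eq_iff] at hxy
  exact Matrix.vecMul_injective_iff_isUnit.2 h1.isUnit hxy.1

theorem GT_rank {k : Fin 2} (hG : Function.Injective (R.G k k).vecMul) :
    (R.GT k).rank = R.dγ k := by
  have hinj : Function.Injective (R.GT k).mulVecLin := by
    intro x y hxy
    simp only [Matrix.mulVecLin_apply, GT, Matrix.mulVec_transpose, Matrix.vecMul_fromCols,
      Sum.elim_eq_iff, Matrix.vecMul_neg, neg_inj] at hxy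
    apply hG
    clear hG
    fin_cases k
    · exact hxy.1
    · exact hxy.2
  rw [Matrix.rank, LinearMap.finrank_range_of_inj hinj]
  simp

/-- The summand of side `k` is definite by injectivity; the other is only semidefinite, which
suffices. -/
theorem schur_posDef {k : Fin 2} (hM : ∀ i, (R.M i).PosDef)
    (hG : Function.Injective (R.G k k).vecMul) : (R.schur k).PosDef := by
  have h1 : ∀ i, (R.G k i * (R.M i)⁻¹ * (R.G k i)ᵀ).PosSemidef := fun i => by
    rw [← Matrix.conjTranspose_eq_transpose_of_trivial]
    exact (hM i).inv.posSemidef.mul_mul_conjTranspose_same _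
  have h2 : (R.G k k * (R.M k)⁻¹ * (R.G k k)ᵀ).PosDef := by
    rw [← Matrix.conjTranspose_eq_transpose_of_trivial]
    exact (hM k).inv.mul_mul_conjTranspose_same hG
  rw [schur]
  clear hG
  fin_cases k
  · exact h2.add_posSemidef (h1 1)
  · exact Matrix.PosDef.posSemidef_add (h1 0) h2

end Constraint

end ReducedBasis

/-- The `L²` norm on a subdomain of a finite element function with interface degrees of freedom
is bounded by the square root of the mesh size times the norm of its trace. -/
theorem exists_sqrt_setIntegral_le (n : ℕ) {σ : ℝ} (hσ : 0 < σ) : ∃ C : ℝ, 0 < C ∧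
    ∀ (P : Coupled (n + 1)), P.Admissible → ∀ (i : Fin 2) (h : ℝ), 0 < h →
      (P.mesh i).QuasiUniform h σ → ∀ (R : P.ReducedBasis), ∀ v ∈ R.Sγ i,
      Real.sqrt (∫ p in P.Ω i, v p ^ 2) ≤ C * Real.sqrt h * P.normW (P.trace v) := by
  obtain ⟨κ, hκ, hle⟩ := exists_sum_sq_le_surface n hσ
  set B := volume.real (Metric.ball (0 : Pt (n + 1)) 1) with hB
  have hB0 : 0 < B := ENNReal.toReal_pos (Metric.measure_ball_pos _ _ one_pos).ne'
    measure_ball_lt_top.ne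
  refine ⟨Real.sqrt (σ ^ (n + 1) * B / κ), by positivity, ?_⟩
  intro P hP i h hh hq R v hv
  obtain ⟨c, hc, rfl⟩ := R.exists_fe_of_mem_Sγ hv
  have h1 := (hP.conforming i).setIntegral_region_fe_sq_le hh hσ hq c
  have h2 := hle P hP i h hh hq c hc
  have h3 : P.normW (P.trace ((P.mesh i).fe c)) =
      Real.sqrt (∫ p in P.γ, (P.mesh i).fe c p ^ 2 ∂μHE[n]) := by
    rw [← integral_surface]
    rfl
  rw [h3, ← Real.sqrt_mul (by positivity), ← Real.sqrt_mul (by positivity)]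
  refine Real.sqrt_le_sqrt (h1.trans ?_)
  -- The volume scales like `h ^ (n + 1)` and the surface like `h ^ n`; the remaining factor `h`
  -- gives `√h` after taking roots.
  calc (σ * h) ^ (n + 1) * B * ∑ r, c r ^ 2
      = σ ^ (n + 1) * B / κ * h * (κ * h ^ n * ∑ r, c r ^ 2) := by
        field_simp
        ring
    _ ≤ _ := by gcongr

end Coupled

end CoupledFEM

theorem lemma2 (ν : ℕ) (hν : ν = 2 ∨ ν = 3) (σ : ℝ) (hσ : 0 < σ) :
    ∃ β C : ℝ, 0 < β ∧ 0 < C ∧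
      ∀ (P : CoupledFEM.Coupled ν), P.Admissible →
      ∀ (h : Fin 2 → ℝ), (∀ i, 0 < h i) → (∀ i, (P.mesh i).QuasiUniform (h i) σ) →
      ∀ (R : P.ReducedBasis) (k : Fin 2), 0 < R.dγ k →
        -- the lifting operator
        (∃ Q : R.W k →ₗ[ℝ] R.V, ∀ μ : R.W k,
          P.b (Q μ).1 μ.1 = P.normW μ.1 ^ 2 ∧
          P.normV (Q μ).1 ≤ C * Real.sqrt (h k) * P.normW μ.1) ∧
        -- the inf-sup condition
        (h k < 1 → R.InfSup k β) ∧
        -- coercivity of the mass form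
        (∀ v ∈ R.V, P.normV v ^ 2 ≤ P.a v v) ∧
        -- projected mass matrices, constraint matrix, Schur complement
        (∀ i, (R.M i).PosDef) ∧
        (R.GT k).rank = R.dγ k ∧
        (R.schur k).PosDef := by
  obtain ⟨n, rfl⟩ : ∃ n, ν = n + 1 := ⟨ν - 1, by omega⟩
  obtain ⟨C, hC, hbound⟩ := CoupledFEM.Coupled.exists_sqrt_setIntegral_le n hσ
  obtain ⟨κ, hκ, hsurf⟩ := CoupledFEM.Coupled.exists_sum_sq_le_surface n hσ
  -- For `h k < 1` the factor `√(h k)` in the lifting bound is at most 1, which leaves `β = C⁻¹`.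
  refine ⟨C⁻¹, C, inv_pos.2 hC, hC, ?_⟩
  intro P hP h hh hq R k hk
  obtain ⟨Q, hQ⟩ := R.exists_lifting (hbound P hP k (h k) (hh k) (hq k) R)
  have hM := R.M_posDef n.succ_pos hσ hP hh hq
  have hκh : 0 < κ * h k ^ n := mul_pos hκ (pow_pos (hh k) n)
  have hG := R.G_self_vecMul_injective
    (CoupledFEM.Coupled.ReducedBasis.constraint_self_posDef hP hκh
      (hsurf P hP k (h k) (hh k) (hq k)))
  refine ⟨⟨Q, hQ⟩, fun hk1 => ?_, fun v _ => CoupledFEM.Coupled.ReducedBasis.normV_sq_le_a v,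
    hM, R.GT_rank hG, R.schur_posDef hM hG⟩
  refine R.infSup_of_lifting hC
    (fun v hv h0 => R.eq_zero_of_normV n.succ_pos hσ hP hh hq hv h0)
    (R.exists_ne_zero_mem_V hP hk) fun μ hμ => ?_
  refine ⟨(Q ⟨μ, hμ⟩).1, (Q ⟨μ, hμ⟩).2, (hQ ⟨μ, hμ⟩).1, (hQ ⟨μ, hμ⟩).2.trans ?_⟩
  have h1 : Real.sqrt (h k) ≤ 1 := Real.sqrt_le_one.2 hk1.le
  have h2 : 0 ≤ P.normW μ := Real.sqrt_nonneg _
  calc C * Real.sqrt (h k) * P.normW μ ≤ C * 1 * P.normW μ := by gcongr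
    _ = C * P.normW μ := by rw [mul_one]
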